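/- Let $R$ be a Noetherian local (commutative) ring of Krull dimension $0$ with residue field $\mathbf k$. Let $\mathscr D^b_{\mathrm{coh}}(\operatorname{Spec} R)$ be the stable $\infty$-category of complexes of $R$-modules with bounded, finitely generated cohomology, and let $\mathbf M_R$ be the homotopy category of $\mathscr D^b_{\mathrm{coh}}(\operatorname{Spec} R)^{\Delta^1}$; equivalently, $\mathbf M_R$ is the full triangulated subcategory of the derived category of the abelian category of morphisms of $R$-modules consisting of those complexes of morphisms $[E\to F]$ for which the cohomology of both $E$ and $F$ is bounded and finitely generated. Let $\sigma=(Z,\mathcal P)$ be a locally finite (Bridgeland) stability condition on the triangulated category $\mathbf M_R$. Call an object of $\mathbf M_R$ $\sigma$-stable if it is a simple object of $\mathcal P(\phi)$ for some $\phi\in\mathbb R$. If $f\in\mathbf M_R$ is $\sigma$-stable, then there is an integer $n$ such that $f$ is isomorphic in $\mathbf M_R$ to $X[n]$, where $X$ is one of the three objects $$s(\mathbf k)=[\mathrm{id}\colon \mathbf k\to\mathbf k],\qquad j_!(\mathbf k)=[\mathbf k\to 0],\qquad j_*(\mathbf k)=[0\to\mathbf k]$$ (with $\mathbf k$ placed in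 degree $0$). -/

import Mathlib

open CategoryTheory Limits Pretriangulated

universe w v u

noncomputable section

/-! ### Stability conditions on triangulated categories -/

namespace Bridgeland

section

variable (C : Type u) [Category.{v} C] [Preadditive C] [HasZeroObject C] [HasShift C ℤ]
  [∀ n : ℤ, (shiftFunctor C n).Additive] [Pretriangulated C]

/-- The relations `[Y] = [X] + [Z]`, one for each distinguished triangle `X ⟶ Y ⟶ Z ⟶ X⟦1⟧`. -/
def k0Relations : AddSubgroup (FreeAbelianGroup C) :=
  AddSubgroup.closure {x | ∃ T ∈ distTriang C,
    x = FreeAbelianGroup.of T.obj₂ - (FreeAbelianGroup.of T.obj₁ + FreeAbelianGroup.of T.obj₃)}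

/-- The Grothendieck group of a triangulated category. -/
abbrev K0 : Type u := FreeAbelianGroup C ⧸ k0Relations C

variable {C}

/-- The class of an object in the Grothendieck group. -/
def K0.cls (X : C) : K0 C := QuotientAddGroup.mk (FreeAbelianGroup.of X)

/-- The extension closure of a class `Q` of objects of a triangulated category: the smallest class
of objects which contains `Q` and, for each distinguished triangle `X ⟶ Y ⟶ Z ⟶ X⟦1⟧`, contains `Y`
as soon as it contains `X` and `Z`. -/
inductive ExtensionClosure (Q : ObjectProperty C) : C → Prop
  | of (X : C) (hX : Q X) : ExtensionClosure Q X
  | ext (T : Triangle C) (hT : T ∈ distTriang C) (h₁ : ExtensionClosure Q T.obj₁)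
      (h₃ : ExtensionClosure Q T.obj₃) : ExtensionClosure Q T.obj₂

variable (C) in
/-- A stability condition `(Z, P)` on a triangulated category: a group homomorphism
`Z : K₀ ⟶ ℂ` and a family of (strictly) full additive subcategories `P φ`, `φ ∈ ℝ`. -/
structure StabilityCondition where
  /-- the central charge -/
  Z : K0 C →+ ℂ
  /-- the slicing -/
  P : ℝ → ObjectProperty C
  isClosedUnderIsomorphisms (φ : ℝ) : (P φ).IsClosedUnderIsomorphisms
  /-- This includes the empty product: the zero objects belong to `P φ`. -/
  isClosedUnderFiniteProducts (φ : ℝ) : (P φ).IsClosedUnderFiniteProducts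
  exists_mass (φ : ℝ) (X : C) (hX : P φ X) (hX₀ : ¬ IsZero X) :
    ∃ m : ℝ, 0 < m ∧ Z (K0.cls X) = m * Complex.exp (Complex.I * Real.pi * φ)
  shift_iff (φ : ℝ) (X : C) : P (φ + 1) (X⟦(1 : ℤ)⟧) ↔ P φ X
  hom_eq_zero (φ₁ φ₂ : ℝ) (h : φ₂ < φ₁) (X Y : C) (hX : P φ₁ X) (hY : P φ₂ Y) (f : X ⟶ Y) : f = 0
  /-- The Harder-Narasimhan property: a nonzero object `X` has a finite filtration
  `0 = E 0 ⟶ E 1 ⟶ ⋯ ⟶ E n ≅ X` whose `i`-th cone `A` lies in `P (φ i)`, with `φ` decreasing. -/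
  exists_hn (X : C) (hX : ¬ IsZero X) :
    ∃ (n : ℕ) (E : Fin (n + 1) → C) (φ : Fin n → ℝ), StrictAnti φ ∧
      IsZero (E 0) ∧ Nonempty (E (Fin.last n) ≅ X) ∧
      ∀ i : Fin n, ∃ (A : C) (f : E i.castSucc ⟶ E i.succ) (g : E i.succ ⟶ A)
        (h : A ⟶ (E i.castSucc)⟦(1 : ℤ)⟧), P (φ i) A ∧ Triangle.mk f g h ∈ distTriang C

/-- A (quasi-abelian) category is of finite length if every object satisfies the ascending
and the descending chain condition on its strict subobjects, i.e. on those subobjects which are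
the kernel of some morphism. -/
def IsOfFiniteLength (A : Type u) [Category.{v} A] [HasZeroMorphisms A] : Prop :=
  ∀ X : A,
    WellFoundedGT {S : Subobject X // Nonempty (NormalMono S.arrow)} ∧
    WellFoundedLT {S : Subobject X // Nonempty (NormalMono S.arrow)}

namespace StabilityCondition

variable (σ : StabilityCondition C)

/-- For a set `I` of phases, `P(I)` is the extension closure of the `P φ` with `φ ∈ I`. -/
def interval (I : Set ℝ) : ObjectProperty C :=
  ExtensionClosure fun X => ∃ φ ∈ I, σ.P φ X

/-- A stability condition is locally finite if for some `η > 0` all the quasi-abelian categories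
`P((t - η, t + η))` are of finite length. (`P(I)` is quasi-abelian for intervals of length `< 1`,
and the condition gets weaker when `η` decreases, whence `η < 1 / 2`.) -/
def IsLocallyFinite : Prop :=
  ∃ η : ℝ, 0 < η ∧ η < 1 / 2 ∧
    ∀ t : ℝ, IsOfFiniteLength (σ.interval (Set.Ioo (t - η) (t + η))).FullSubcategory

/-- An object is `σ`-stable if it is a simple object of one of the categories `P φ`. -/
def IsStable (X : C) : Prop :=
  ∃ (φ : ℝ) (hX : σ.P φ X), Simple (⟨X, hX⟩ : (σ.P φ).FullSubcategory)

end StabilityCondition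

end

end Bridgeland

/-! ### The category of morphisms in the derived category of a Noetherian ring -/

namespace MorphismCategory

section

variable (R : Type u) [CommRing R]

/-- The abelian category of morphisms of `R`-modules. -/
abbrev ModArrow : Type (u + 1) := ComposableArrows (ModuleCat.{u} R) 1

/-- Morphisms between finitely generated `R`-modules. -/
def coherent : ObjectProperty (ModArrow R) :=
  fun F => ∀ i, Module.Finite R (F.obj i)

instance [IsNoetherianRing R] : (coherent R).IsSerreClass where
  exists_zero := ⟨(Functor.const _).obj (ModuleCat.of R PUnit),
    Functor.isZero _ fun i => ModuleCat.isZero_of_subsingleton (ModuleCat.of R PUnit),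
    fun i => (inferInstance : Module.Finite R PUnit.{u + 1})⟩
  prop_of_mono {F G} f hf hG i := by
    have := hG i
    have hi : Function.Injective (f.app i) := by
      rw [← ModuleCat.mono_iff_injective]; infer_instance
    exact Module.Finite.of_injective (f.app i).hom hi
  prop_of_epi {F G} f hf hF i := by
    have := hF i
    have hi : Function.Surjective (f.app i) := by
      rw [← ModuleCat.epi_iff_surjective]; infer_instance
    exact Module.Finite.of_surjective (f.app i).hom hi
  prop_X₂_of_shortExact {S} hS h₁ h₃ i := by
    have hS' := hS.map_of_exact ((evaluation _ (ModuleCat.{u} R)).obj i)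
    have : Module.Finite R (S.map ((evaluation _ (ModuleCat.{u} R)).obj i)).X₁ := h₁ i
    have : Module.Finite R (S.map ((evaluation _ (ModuleCat.{u} R)).obj i)).X₃ := h₃ i
    exact Module.Finite.of_exact
      ((ShortComplex.ShortExact.moduleCat_exact_iff_function_exact _).1 hS'.exact)
      hS'.moduleCat_surjective_g

variable [HasDerivedCategory.{w} (ModArrow R)]

/-- The objects with cohomology in `coherent R`. -/
def coherentCohomology : ObjectProperty (DerivedCategory (ModArrow R)) :=
  fun X => ∀ n : ℤ, coherent R ((DerivedCategory.homologyFunctor (ModArrow R) n).obj X)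

instance [IsNoetherianRing R] : (coherentCohomology R).IsClosedUnderIsomorphisms where
  of_iso e hX n :=
    (coherent R).prop_of_iso ((DerivedCategory.homologyFunctor (ModArrow R) n).mapIso e) (hX n)

instance [IsNoetherianRing R] : (coherentCohomology R).IsTriangulated where
  exists_zero := ⟨_, isZero_zero (DerivedCategory (ModArrow R)), fun n =>
    (coherent R).prop_of_isZero ((DerivedCategory.homologyFunctor _ n).map_isZero (isZero_zero _))⟩
  isStableUnderShiftBy a := ⟨fun X hX n => (coherent R).prop_of_iso
    (((DerivedCategory.homologyFunctor (ModArrow R) 0).shiftIso a n (a + n) rfl).app X).symm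
    (hX (a + n))⟩
  toIsTriangulatedClosed₂ := .mk' fun T hT h₁ h₃ n =>
    (coherent R).prop_X₂_of_exact (DerivedCategory.HomologySequence.exact₂ T hT n) (h₁ n) (h₃ n)

/-- The complexes of morphisms of `R`-modules (that is, the morphisms `E ⟶ F` of complexes of
`R`-modules) for which the cohomology of `E` and of `F` is bounded and finitely generated. -/
def boundedCoherent : ObjectProperty (DerivedCategory (ModArrow R)) :=
  coherentCohomology R ⊓ (DerivedCategory.TStructure.t (C := ModArrow R)).bounded

instance [IsNoetherianRing R] : (boundedCoherent R).IsClosedUnderIsomorphisms :=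
  inferInstanceAs (coherentCohomology R ⊓ _).IsClosedUnderIsomorphisms

instance [IsNoetherianRing R] : (boundedCoherent R).IsTriangulated :=
  inferInstanceAs (coherentCohomology R ⊓ _).IsTriangulated

/-- The triangulated category `M_R` of morphisms in the bounded derived category of coherent
sheaves on `Spec R`. Morphisms of complexes of `R`-modules are complexes of morphisms of
`R`-modules, and inverting the morphisms that are quasi-isomorphisms on source and target presents
the homotopy category of the `∞`-category of functors from `Δ¹` to the derived `∞`-category of
`R`-modules; `M_R` is the full subcategory of the morphisms `E ⟶ F` such that `E` and `F` have
bounded coherent cohomology. -/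
abbrev MR : Type (u + 1) := (boundedCoherent R).FullSubcategory

variable {R}

/-- A morphism `f : M ⟶ N` of finitely generated `R`-modules as an object of `M_R`, with
`M` and `N` in degree zero. -/
def ofHom {M N : ModuleCat.{u} R} [hM : Module.Finite R M] [hN : Module.Finite R N]
    (f : M ⟶ N) [IsNoetherianRing R] : MR R where
  obj := (DerivedCategory.singleFunctor (ModArrow R) 0).obj (ComposableArrows.mk₁ f)
  property := by
    refine ⟨fun n => ?_, ⟨0, inferInstance⟩, ⟨0, inferInstance⟩⟩
    by_cases hn : n = 0
    · subst hn
      refine (coherent R).prop_of_iso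
        ((DerivedCategory.singleFunctorCompHomologyFunctorIso (ModArrow R) 0).app _).symm ?_
      intro i
      fin_cases i
      · exact hM
      · exact hN
    · refine (coherent R).prop_of_isZero ?_
      rcases lt_or_gt_of_ne hn with h | h
      · exact DerivedCategory.isZero_of_isGE _ 0 n h
      · exact DerivedCategory.isZero_of_isLE _ 0 n h

variable [IsNoetherianRing R]

/-- `s(M) = [id : M ⟶ M]` -/
def s (M : ModuleCat.{u} R) [Module.Finite R M] : MR R := ofHom (𝟙 M)

/-- `j_!(M) = [M ⟶ 0]` -/
def jShriek (M : ModuleCat.{u} R) [Module.Finite R M] : MR R :=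
  ofHom (0 : M ⟶ ModuleCat.of R PUnit.{u + 1})

/-- `j_*(M) = [0 ⟶ M]` -/
def jStar (M : ModuleCat.{u} R) [Module.Finite R M] : MR R :=
  ofHom (0 : ModuleCat.of R PUnit.{u + 1} ⟶ M)

end

end MorphismCategory

end

open scoped ZeroObject

noncomputable section

/-! A stable object `X` resembles a simple one in two ways. Comparing phases, it has no nonzero map
to `X⟦n⟧` for `n < 0`; and composites of its nonzero endomorphisms are nonzero
(`IsStable.comp_ne_zero`). Suppose that a nonzero map `X ⟶ X⟦n⟧`, `n ≤ 0`, factors through an object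
`S` whose nonzero endomorphisms are invertible. Then `n = 0`, and `S` is the image of a nonzero
idempotent of `X`, which must be the identity; so `X ≅ S` (`IsStable.nonempty_iso`).

It remains to find such a factorization, for every nonzero `X` in `M_R`, through a shift of one of
the three arrows (`hasFactorization`); stability plays no role here. As `R` is Artinian, a nonzero
finitely generated module has `k` both as a quotient and as a submodule. Let `[M_n ⟶ N_n]` be the
homology of `X`, with lowest and highest nonzero degrees `a` and `b`. - If `M_b ⟶ N_b` is not onto,
`[0 ⟶ k]` works, through `N_b ⟶ k ⟶ N_c` with `N_c` the lowest nonzero target. - If it is onto and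
`N_b ≠ 0`, `[k = k]` works, through `M_b ⟶ k ⟶ M_c` with `M_c` the lowest nonzero source. - If `N_b
= 0` and `M_a ⟶ N_a` is not injective, `[k ⟶ 0]` works, through `M_b ⟶ k ⟶ M_a`. - If `N_b = 0`,
`M_a ≠ 0` and `M_a ⟶ N_a` is injective, `[k = k]` works, through `N_c ⟶ k ⟶ N_a` with `N_c` the
highest nonzero target. - If `N_b = 0` and `M_a = 0`, the connecting map `[k ⟶ 0] ⟶ [0 ⟶ k]⟦1⟧` is
inserted between the two ends. Homology detects the first four composites (`exists_comp_ne_zero`)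
but not the last one (`exists_comp_ne_zero_of_shortExact`). -/

namespace Bridgeland

namespace StabilityCondition

/-! ### Orthogonality and phases in a slicing. -/

section

variable {C : Type u} [Category.{v} C] [HasZeroMorphisms C]

lemma _root_.CategoryTheory.ObjectProperty.rightOrthogonal_leftOrthogonal_mono {P Q : ObjectProperty C} (h : P ≤ Q) :
    P.rightOrthogonal.leftOrthogonal ≤ Q.rightOrthogonal.leftOrthogonal :=
  fun _ hX _ f hY => hX f fun _ g hZ => hY g (h _ hZ)

lemma _root_.CategoryTheory.ObjectProperty.leftOrthogonal_rightOrthogonal_mono {P Q : ObjectProperty C} (h : P ≤ Q) :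
    P.leftOrthogonal.rightOrthogonal ≤ Q.leftOrthogonal.rightOrthogonal :=
  fun _ hX _ f hY => hX f fun _ g hZ => hY g (h _ hZ)

end

section

variable {C : Type u} [Category.{v} C] [Preadditive C] [HasShift C ℤ]
  [∀ n : ℤ, (shiftFunctor C n).Additive]

lemma eq_zero_of_shift_map_eq_zero {X Y : C} (n : ℤ) (f : X ⟶ Y) (hf : f⟦n⟧' = 0) : f = 0 :=
  (shiftFunctor C n).map_injective (by rw [hf, Functor.map_zero])

/-- Maps out of a shifted object correspond to maps into an object shifted back. -/
lemma hom_shift_eq_zero {X Y : C} (n m : ℤ) (h : n + m = 0) (H : ∀ g : X ⟶ Y⟦m⟧, g = 0)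
    (f : X⟦n⟧ ⟶ Y) : f = 0 := by
  apply eq_zero_of_shift_map_eq_zero m
  rw [← cancel_epi ((shiftFunctorCompIsoId C n m h).inv.app X), comp_zero]
  exact H _

lemma hom_to_shift_eq_zero {X Y : C} (n m : ℤ) (h : n + m = 0) (H : ∀ g : X⟦m⟧ ⟶ Y, g = 0)
    (f : X ⟶ Y⟦n⟧) : f = 0 := by
  apply eq_zero_of_shift_map_eq_zero m
  rw [← cancel_mono ((shiftFunctorCompIsoId C n m h).hom.app Y), zero_comp]
  exact H _

end

/-- The index is the first `j` with `φ j ≤ t`, or the last one if there is none; a Harder-Narasimhan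
filtration is cut there at phase `t`. -/
lemma exists_threshold {n : ℕ} (φ : Fin n → ℝ) (hφ : StrictAnti φ) (t : ℝ) :
    ∃ i : Fin (n + 1), ∀ j : Fin n, j.castSucc < i ↔ t < φ j := by
  classical
  by_cases h : ∃ j, ¬ t < φ j
  · obtain ⟨j, hj, hmin⟩ := WellFounded.has_min (wellFounded_lt (α := Fin n)) {j | ¬ t < φ j} h
    refine ⟨j.castSucc, fun k => ⟨fun hk => ?_, fun hk => ?_⟩⟩
    · by_contra hk'
      exact hmin k hk' (by simpa using hk)
    · by_contra hk'
      have : j ≤ k := by simpa using hk'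
      exact hj (hk.trans_le (hφ.antitone this))
  · push Not at h
    exact ⟨Fin.last n, fun j => by simp [h j, Fin.castSucc_lt_last]⟩

variable {C : Type u} [Category.{v} C] [Preadditive C] [HasZeroObject C] [HasShift C ℤ]
  [∀ n : ℤ, (shiftFunctor C n).Additive] [Pretriangulated C] (σ : StabilityCondition C)

instance (φ : ℝ) : (σ.P φ).IsClosedUnderIsomorphisms := σ.isClosedUnderIsomorphisms φ

lemma prop_of_isZero (φ : ℝ) {X : C} (hX : IsZero X) : σ.P φ X := by
  have := σ.isClosedUnderFiniteProducts φ
  exact (σ.P φ).prop_of_isLimit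
    (isLimitChangeEmptyCone C hX.isTerminal (asEmptyCone X) (Iso.refl X)) (by rintro ⟨⟨⟩⟩)

lemma shift_int_iff (n : ℤ) (φ : ℝ) (X : C) : σ.P (φ + n) (X⟦n⟧) ↔ σ.P φ X := by
  induction n using Int.induction_on generalizing φ X with
  | zero =>
    simpa using (σ.P φ).prop_iff_of_iso ((shiftFunctorZero C ℤ).app X)
  | succ i hi =>
    rw [← hi φ X, ← σ.shift_iff (φ + (i : ℤ))]
    push_cast
    rw [← add_assoc]
    exact (σ.P _).prop_iff_of_iso ((shiftFunctorAdd C (i : ℤ) 1).app X)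
  | pred i hi =>
    rw [← hi φ X, ← σ.shift_iff (φ + ((-i - 1 : ℤ) : ℝ))]
    have : φ + ((-i - 1 : ℤ) : ℝ) + 1 = φ + ((-i : ℤ) : ℝ) := by push_cast; ring
    rw [this]
    exact (σ.P _).prop_iff_of_iso ((shiftFunctorAdd' C (-i - 1 : ℤ) 1 (-i : ℤ) (by ring)).symm.app X)

/-- The objects which are semistable of some phase in `I`. -/
def phases (I : Set ℝ) : ObjectProperty C := fun X => ∃ φ ∈ I, σ.P φ X

lemma phases_mono {I J : Set ℝ} (h : I ⊆ J) : σ.phases I ≤ σ.phases J :=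
  fun _ ⟨φ, hφ, hX⟩ => ⟨φ, h hφ, hX⟩

lemma shift_rightOrthogonal (φ : ℝ) {Y : C}
    (hY : (σ.phases (Set.Ioi φ)).rightOrthogonal Y) :
    (σ.phases (Set.Ioi φ)).rightOrthogonal (Y⟦(-1 : ℤ)⟧) := by
  rintro X f ⟨ψ, hψ, hX⟩
  refine hom_to_shift_eq_zero (-1) 1 (by simp) (fun g => hY g ⟨ψ + 1, ?_, ?_⟩) f
  · simp only [Set.mem_Ioi] at *; linarith
  · exact (σ.shift_iff _ _).2 hX

lemma phases_le_leftOrthogonal {I J : Set ℝ} (h : ∀ i ∈ I, ∀ j ∈ J, j < i) :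
    σ.phases I ≤ (σ.phases J).leftOrthogonal := by
  rintro X ⟨i, hi, hX⟩ Y f ⟨j, hj, hY⟩
  exact σ.hom_eq_zero i j (h i hi j hj) X Y hX hY f

lemma rightOrthogonal_of_leftOrthogonal {I J : Set ℝ} (h : ∀ i ∈ I, ∀ j ∈ J, j < i) {Y : C}
    (hY : (σ.phases J).leftOrthogonal.rightOrthogonal Y) : (σ.phases I).rightOrthogonal Y :=
  fun _ f hX => hY f (σ.phases_le_leftOrthogonal h _ hX)

lemma leftOrthogonal_of_rightOrthogonal {I J : Set ℝ} (h : ∀ i ∈ I, ∀ j ∈ J, j < i) {X : C}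
    (hX : (σ.phases I).rightOrthogonal.leftOrthogonal X) : (σ.phases J).leftOrthogonal X :=
  fun _ f hY => hX f fun _ g hZ => σ.phases_le_leftOrthogonal h _ hZ g hY

variable {σ} in
lemma IsStable.hom_shift_eq_zero {X : C} (hX : σ.IsStable X) {n : ℤ} (hn : n < 0)
    (f : X ⟶ X⟦n⟧) : f = 0 := by
  obtain ⟨φ, hX, -⟩ := hX
  refine σ.hom_eq_zero φ (φ + n) ?_ _ _ hX ((σ.shift_int_iff _ _ _).2 hX) f
  have : (n : ℝ) < 0 := by exact_mod_cast hn
  linarith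

/-! ### Harder-Narasimhan truncation and stable objects. -/

section

variable [IsTriangulated C]

/-- Double orthogonals stand in for extension closures: they contain the given semistable objects
and are closed under extensions. Upward induction treats `E i`, downward induction its cone in `X`.
-/
lemma exists_hn_triangles (X : C) (hX : ¬ IsZero X) :
    ∃ (n : ℕ) (E : Fin (n + 1) → C) (φ : Fin n → ℝ), StrictAnti φ ∧
      (∀ i : Fin n, ∃ (A : C) (f : E i.castSucc ⟶ E i.succ) (g : E i.succ ⟶ A)
        (h : A ⟶ (E i.castSucc)⟦(1 : ℤ)⟧), σ.P (φ i) A ∧ Triangle.mk f g h ∈ distTriang C) ∧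
      IsZero (E 0) ∧ Nonempty (E (Fin.last n) ≅ X) ∧
      ∀ i : Fin (n + 1), ∃ (G : C) (e : E i ⟶ X) (g : X ⟶ G) (h : G ⟶ (E i)⟦(1 : ℤ)⟧),
        Triangle.mk e g h ∈ distTriang C ∧
        (σ.phases (φ '' {j | j.castSucc < i})).rightOrthogonal.leftOrthogonal (E i) ∧
        (σ.phases (φ '' {j | i ≤ j.castSucc})).leftOrthogonal.rightOrthogonal G := by
  obtain ⟨n, E, φ, hφ, h0, ⟨e⟩, hA⟩ := σ.exists_hn X hX
  have hE : ∀ i : Fin (n + 1),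
      (σ.phases (φ '' {j | j.castSucc < i})).rightOrthogonal.leftOrthogonal (E i) := by
    intro i
    induction i using Fin.induction with
    | zero => exact fun Y f _ => h0.eq_of_src _ _
    | succ i hi =>
      obtain ⟨A, f, g, h, hA, hT⟩ := hA i
      refine ObjectProperty.ext_of_isTriangulatedClosed₂ _ _ hT ?_ ?_
      · refine ObjectProperty.rightOrthogonal_leftOrthogonal_mono (σ.phases_mono (Set.image_mono ?_)) _ hi
        intro j hj
        exact lt_trans hj i.castSucc_lt_succ
      · exact fun Y f hY => hY f ⟨φ i, ⟨i, i.castSucc_lt_succ, rfl⟩, hA⟩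
  refine ⟨n, E, φ, hφ, hA, h0, ⟨e⟩, fun i => ?_⟩
  induction i using Fin.reverseInduction with
  | last =>
    refine ⟨0, e.hom, 0, 0, ?_, hE _, fun Y f _ => (isZero_zero C).eq_of_tgt _ _⟩
    rw [Triangle.distinguished_iff_of_isZero₃ _ (isZero_zero C)]
    exact inferInstanceAs (IsIso e.hom)
  | cast i hi =>
    obtain ⟨G, e', g', h', hT, -, hG⟩ := hi
    obtain ⟨A, f, g, h, hA, hT'⟩ := hA i
    obtain ⟨G', g'', h'', hT''⟩ := distinguished_cocone_triangle (f ≫ e')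
    -- This makes `G'` an extension of `G` by the factor `A`.
    let o := Triangulated.someOctahedron rfl hT' hT hT''
    refine ⟨G', f ≫ e', g'', h'', hT'', hE _, ?_⟩
    refine ObjectProperty.ext_of_isTriangulatedClosed₂ _ _ o.mem ?_ ?_
    · exact fun Y f hY => hY f ⟨φ i, ⟨i, le_refl i.castSucc, rfl⟩, hA⟩
    · refine ObjectProperty.leftOrthogonal_rightOrthogonal_mono (σ.phases_mono (Set.image_mono ?_)) _ hG
      intro j hj
      exact i.castSucc_lt_succ.le.trans hj

/-- The truncation triangle of an object with respect to the phases `> t` and `≤ t`. -/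
lemma exists_truncation_triangle (X : C) (t : ℝ) :
    ∃ (U Q : C) (u : U ⟶ X) (q : X ⟶ Q) (h : Q ⟶ U⟦(1 : ℤ)⟧), Triangle.mk u q h ∈ distTriang C ∧
      (σ.phases (Set.Iic t)).leftOrthogonal U ∧ (σ.phases (Set.Ioi t)).rightOrthogonal Q := by
  by_cases hX : IsZero X
  · exact ⟨X, 0, 𝟙 X, 0, 0, contractible_distinguished X, fun Y f _ => hX.eq_of_src _ _,
      fun Y f _ => (isZero_zero C).eq_of_tgt _ _⟩
  · obtain ⟨n, E, φ, hφ, -, -, -, H⟩ := σ.exists_hn_triangles X hX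
    obtain ⟨i, hi⟩ := exists_threshold φ hφ t
    obtain ⟨G, e, g, h, hT, hE, hG⟩ := H i
    refine ⟨E i, G, e, g, h, hT, σ.leftOrthogonal_of_rightOrthogonal ?_ hE,
      σ.rightOrthogonal_of_leftOrthogonal ?_ hG⟩
    · rintro _ ⟨j, hj, rfl⟩ k hk
      exact lt_of_le_of_lt hk ((hi j).1 hj)
    · rintro k hk _ ⟨j, hj, rfl⟩
      refine lt_of_le_of_lt ?_ hk
      by_contra h
      exact absurd ((hi j).2 (by simpa using h)) (not_lt.2 hj)

/-- The hypotheses kill the maps between `X` and the parts of its filtration of phase above or below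
`φ`. A splitting argument then shows that these parts vanish, so only the factor of phase `φ` is
left. -/
lemma prop_of_orthogonal {φ : ℝ} {X : C} (h₁ : (σ.phases (Set.Iio φ)).leftOrthogonal X)
    (h₂ : (σ.phases (Set.Ioi φ)).rightOrthogonal X) : σ.P φ X := by
  by_cases hX : IsZero X
  · exact σ.prop_of_isZero φ hX
  obtain ⟨n, E, ψ, hψ, hA, -, ⟨e₀⟩, H⟩ := σ.exists_hn_triangles X hX
  obtain ⟨i, hi⟩ := exists_threshold ψ hψ φ
  -- `E i` is the part of phases above `φ`. As `E i ⟶ X` vanishes, `(E i)⟦1⟧` is a direct summand of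
  -- `G`, whose phases are too low for that.
  have hEi : IsZero (E i) := by
    obtain ⟨G, e, g, h, hT, hE, hG⟩ := H i
    have hE' : (σ.phases (Set.Ioi φ)).rightOrthogonal.leftOrthogonal (E i) := by
      refine ObjectProperty.rightOrthogonal_leftOrthogonal_mono (σ.phases_mono ?_) _ hE
      rintro _ ⟨j, hj, rfl⟩
      exact (hi j).1 hj
    have hG' : (σ.phases (Set.Ioi φ)).rightOrthogonal G := by
      refine σ.rightOrthogonal_of_leftOrthogonal ?_ hG
      rintro k hk _ ⟨j, hj, rfl⟩
      refine lt_of_le_of_lt ?_ hk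
      by_contra h
      exact absurd ((hi j).2 (by simpa using h)) (not_lt.2 hj)
    have : Epi h := Triangle.epi₃ _ hT (show e = 0 from hE' e h₂)
    have := isSplitEpi_of_epi h
    have hs : section_ h = 0 :=
      hom_shift_eq_zero 1 (-1) (by simp) (fun g => hE' g (σ.shift_rightOrthogonal φ hG')) _
    have h0 : 𝟙 ((E i)⟦(1 : ℤ)⟧) = 0 := by rw [← IsSplitEpi.id h, hs, zero_comp]
    rw [IsZero.iff_id_eq_zero]
    exact eq_zero_of_shift_map_eq_zero 1 _ (by rw [CategoryTheory.Functor.map_id, h0])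
  have hzero : ∀ (k : Fin (n + 1)), (∀ j : Fin n, k ≤ j.castSucc → ψ j < φ) →
      ∀ G : C, (σ.phases (ψ '' {j | k ≤ j.castSucc})).leftOrthogonal.rightOrthogonal G →
      (σ.phases (Set.Ici φ)).rightOrthogonal G ∧ ∀ g : X ⟶ G, g = 0 := by
    intro k hk G hG
    refine ⟨σ.rightOrthogonal_of_leftOrthogonal ?_ hG, fun g => hG g fun Y f hY => h₁ f ?_⟩
    · rintro a ha _ ⟨j, hj, rfl⟩
      exact lt_of_lt_of_le (hk j hj) ha
    · refine σ.phases_mono ?_ _ hY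
      rintro _ ⟨j, hj, rfl⟩
      exact hk j hj
  induction i using Fin.lastCases with
  | last => exact absurd (hEi.of_iso e₀.symm) hX
  | cast i =>
    have hle : ψ i ≤ φ := by
      by_contra h
      exact absurd ((hi i).2 (by simpa using h)) (lt_irrefl _)
    rcases hle.lt_or_eq with hlt | rfl
    · obtain ⟨G, e, g, h, hT, hE, hG⟩ := H i.castSucc
      have hg := (hzero i.castSucc (fun j hj => (hψ.antitone (by simpa using hj)).trans_lt hlt)
        G hG).2 g
      refine absurd ?_ hX
      exact (Triangle.isZero₂_iff _ hT).2 ⟨hEi.eq_of_src _ _, hg⟩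
    · obtain ⟨A, f, g, h, hA, hT⟩ := hA i
      have : IsIso g := (Triangle.isZero₁_iff_isIso₂ _ hT).1 hEi
      have hP : σ.P (ψ i) (E i.succ) := (σ.P _).prop_of_iso (asIso g).symm hA
      obtain ⟨G, e, g, h, hT, hE, hG⟩ := H i.succ
      obtain ⟨hG', hg⟩ := hzero i.succ (fun j hj => hψ (Fin.succ_le_castSucc_iff.1 hj)) G hG
      -- Dually, `G` is a direct summand of `(E i.succ)⟦1⟧`, of phase `ψ i + 1`, while the phases of
      -- `G` are below `ψ i`.
      have : Mono h := Triangle.mono₃ _ hT (hg g)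
      have := isSplitMono_of_mono h
      have hr : retraction h = 0 :=
        hG' _ ⟨ψ i + 1, by simp, (σ.shift_iff _ _).2 hP⟩
      have hG0 : IsZero G := by
        rw [IsZero.iff_id_eq_zero, ← IsSplitMono.id h, hr, comp_zero]
      have : IsIso e := (Triangle.isZero₃_iff_isIso₁ _ hT).1 hG0
      exact (σ.P _).prop_of_iso (asIso e) hP

/-- A nonzero endomorphism of a stable object is an epimorphism in the category of semistable
objects of the same phase. -/
lemma eq_zero_of_comp_eq_zero {φ : ℝ} {X B : C} (hX : σ.P φ X)
    [Simple (⟨X, hX⟩ : (σ.P φ).FullSubcategory)] (hB : σ.P φ B) (f : X ⟶ X) (hf : f ≠ 0)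
    (g : X ⟶ B) (hfg : f ≫ g = 0) : g = 0 := by
  -- The object `I` below is the image of `f` in `P φ`: the cone of `U ⟶ X`, where `U` is the part
  -- of phases above `φ - 1` of the fibre `Z`. As `U⟦1⟧` has phases above `φ`, `p` is epi against
  -- phases `≤ φ`; as `Q` has phases at most `φ - 1`, `I ⟶ X` is mono against phases `≥ φ`.
  obtain ⟨Z, z, w, hT⟩ := distinguished_cocone_triangle₁ f
  obtain ⟨U, Q, u, q, d, hUQ, hU, hQ⟩ := σ.exists_truncation_triangle Z (φ - 1)
  obtain ⟨I, p, k, hI⟩ := distinguished_cocone_triangle (u ≫ z)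
  let o := Triangulated.someOctahedron rfl hUQ hT hI
  have hpi : p ≫ o.m₃ = f := o.comm₃
  have hU' : (σ.phases (Set.Iic φ)).leftOrthogonal (U⟦(1 : ℤ)⟧) := by
    rintro Y y ⟨ψ, hψ, hY⟩
    refine hom_shift_eq_zero 1 (-1) (by simp) (fun y => hU y ⟨ψ + (-1 : ℤ), ?_, ?_⟩) y
    · simp only [Set.mem_Iic] at *; push_cast; linarith
    · exact (σ.shift_int_iff _ _ _).2 hY
  have hp : ∀ ⦃Y : C⦄ (y : I ⟶ Y), σ.phases (Set.Iic φ) Y → p ≫ y = 0 → y = 0 := by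
    intro Y y hY hpy
    obtain ⟨y', hy⟩ := Triangle.yoneda_exact₃ _ hI y hpy
    rw [hy, hU' y' hY]
    exact comp_zero
  have hm : ∀ ⦃Y : C⦄ (y : Y ⟶ I), σ.phases (Set.Ici φ) Y → y ≫ o.m₃ = 0 → y = 0 := by
    intro Y y hY hym
    obtain ⟨y', hy⟩ := Triangle.coyoneda_exact₂ _ o.mem y hym
    obtain ⟨ψ, hψ, hY⟩ := hY
    have : y' = 0 := by
      refine hQ _ ⟨ψ, ?_, hY⟩
      simp only [Set.mem_Ici, Set.mem_Ioi] at *; linarith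
    rw [hy, this]
    exact zero_comp
  have hI' : σ.P φ I := by
    refine σ.prop_of_orthogonal (fun Y y ⟨ψ, hψ, hY⟩ => ?_) (fun Y y ⟨ψ, hψ, hY⟩ => ?_)
    · exact hp y ⟨ψ, Set.mem_Iio.1 hψ |>.le, hY⟩ (σ.hom_eq_zero φ ψ hψ _ _ hX hY _)
    · exact hm y ⟨ψ, Set.mem_Ioi.1 hψ |>.le, hY⟩ (σ.hom_eq_zero ψ φ hψ _ _ hY hX _)
  let m : (⟨I, hI'⟩ : (σ.P φ).FullSubcategory) ⟶ ⟨X, hX⟩ := ObjectProperty.homMk o.m₃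
  have : Mono m := by
    refine Preadditive.mono_of_cancel_zero _ fun {Y} y hy => ?_
    ext
    exact hm y.hom ⟨φ, le_refl φ, Y.property⟩ (congrArg (fun t => t.hom) hy)
  have hm0 : m ≠ 0 := by
    intro h
    apply hf
    have : o.m₃ = 0 := congrArg (fun t => t.hom) h
    rw [← hpi, this, comp_zero]
  -- By simplicity of `X`, `f` agrees with `p` up to an isomorphism, and so inherits its
  -- cancellation property.
  have : IsIso m := isIso_of_mono_of_nonzero hm0
  have : IsIso o.m₃ := (inferInstance : IsIso ((σ.P φ).ι.map m))
  rw [← cancel_epi o.m₃, comp_zero]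
  refine hp _ ⟨φ, le_refl φ, hB⟩ ?_
  exact (Category.assoc _ _ _).symm.trans ((congrArg (· ≫ g) hpi).trans hfg)

variable {σ}

lemma IsStable.comp_ne_zero {X : C} (hX : σ.IsStable X) {f g : X ⟶ X} (hf : f ≠ 0) (hg : g ≠ 0) :
    f ≫ g ≠ 0 := by
  obtain ⟨φ, hX, _⟩ := hX
  exact fun h => hg (σ.eq_zero_of_comp_eq_zero hX hX f hf g h)

/-- A stable object with a nonzero map to some `X⟦n⟧`, `n ≤ 0`, that factors through an object `S`
all of whose nonzero endomorphisms are invertible, is isomorphic to `S`. -/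
lemma IsStable.nonempty_iso {X S : C} (hX : σ.IsStable X)
    (hS : ∀ e : S ⟶ S, e ≠ 0 → IsIso e) {n : ℤ} (hn : n ≤ 0) (a : X ⟶ S) (b : S ⟶ X⟦n⟧)
    (hab : a ≫ b ≠ 0) : Nonempty (X ≅ S) := by
  rcases hn.lt_or_eq with hn | rfl
  · exact absurd (hX.hom_shift_eq_zero hn _) hab
  obtain ⟨b, rfl⟩ : ∃ b' : S ⟶ X, b = b' ≫ (shiftFunctorZero C ℤ).inv.app X :=
    ⟨b ≫ (shiftFunctorZero C ℤ).hom.app X, by simp⟩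
  have hab' : a ≫ b ≠ 0 := by
    intro h
    exact hab (by rw [← Category.assoc, h, zero_comp])
  have h₂ := hX.comp_ne_zero hab' hab'
  have hba : b ≫ a ≠ 0 := by
    intro h
    apply h₂
    rw [Category.assoc, reassoc_of% h, zero_comp, comp_zero]
  have := hS _ hba
  -- The projector for `S` as a retract of `X`.
  let e : X ⟶ X := a ≫ inv (b ≫ a) ≫ b
  have hee : e ≫ e = e := by
    have := IsIso.inv_hom_id_assoc (b ≫ a) (inv (b ≫ a) ≫ b)
    simp only [Category.assoc] at this
    simp only [e, Category.assoc]
    rw [this]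
  have he : e ≠ 0 := by
    intro h
    apply hab'
    have : (a ≫ b) ≫ e = a ≫ b := by
      simp only [e, Category.assoc]
      rw [← Category.assoc b a, IsIso.hom_inv_id_assoc]
    rw [← this, h, comp_zero]
  have he1 : e = 𝟙 X := by
    by_contra h
    refine hX.comp_ne_zero he (g := 𝟙 X - e) (fun h' => h (sub_eq_zero.1 h').symm) ?_
    rw [Preadditive.comp_sub, Category.comp_id, hee, sub_self]
  exact ⟨⟨a, inv (b ≫ a) ≫ b, he1, by simp⟩⟩

end

end StabilityCondition

end Bridgeland

/-! ### Maps in the derived category detected on extreme homology. -/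

namespace DerivedCategory

variable {A : Type u} [Category.{v} A] [Abelian A] [HasDerivedCategory.{w} A]

/-- The homology of a shifted object. -/
def homologyShiftIso (X : DerivedCategory A) (n b c : ℤ) (h : n + b = c) :
    (homologyFunctor A b).obj (X⟦n⟧) ≅ (homologyFunctor A c).obj X :=
  ((homologyFunctor A 0).shiftIso n b c h).app X

lemma homologyShiftIso_hom_naturality {X Y : DerivedCategory A} (f : X ⟶ Y) (n b c : ℤ)
    (h : n + b = c) :
    (homologyFunctor A b).map (f⟦n⟧') ≫ (homologyShiftIso Y n b c h).hom =
      (homologyShiftIso X n b c h).hom ≫ (homologyFunctor A c).map f :=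
  ((homologyFunctor A 0).shiftIso n b c h).hom.naturality f

/-- The homology of a complex concentrated in one degree. -/
def homologySingleIso (S : A) (b : ℤ) :
    (homologyFunctor A b).obj ((singleFunctor A b).obj S) ≅ S :=
  (singleFunctorCompHomologyFunctorIso A b).app S

lemma homologySingleIso_hom_naturality {S T : A} (f : S ⟶ T) (b : ℤ) :
    (homologyFunctor A b).map ((singleFunctor A b).map f) ≫ (homologySingleIso T b).hom =
      (homologySingleIso S b).hom ≫ f :=
  (singleFunctorCompHomologyFunctorIso A b).hom.naturality f

lemma homologySingleIso_inv_naturality {S T : A} (f : S ⟶ T) (b : ℤ) :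
    (homologySingleIso S b).inv ≫ (homologyFunctor A b).map ((singleFunctor A b).map f) =
      f ≫ (homologySingleIso T b).inv :=
  ((singleFunctorCompHomologyFunctorIso A b).inv.naturality f).symm

lemma exists_single_distinguished {T : ShortComplex A} (hT : T.ShortExact) (b : ℤ) :
    ∃ δ : (singleFunctor A b).obj T.X₃ ⟶ ((singleFunctor A b).obj T.X₁)⟦(1 : ℤ)⟧,
      Triangle.mk ((singleFunctor A b).map T.f) ((singleFunctor A b).map T.g) δ ∈
        distTriang (DerivedCategory A) := by
  let e := singleFunctorIsoCompQ A b
  have hT' := hT.map_of_exact (HomologicalComplex.single A (ComplexShape.up ℤ) b)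
  let e₁ : (singleFunctor A b).obj T.X₁ ≅ Q.obj (T.map (HomologicalComplex.single A _ b)).X₁ :=
    e.app T.X₁
  let e₃ : (singleFunctor A b).obj T.X₃ ≅ Q.obj (T.map (HomologicalComplex.single A _ b)).X₃ :=
    e.app T.X₃
  refine ⟨e₃.hom ≫ triangleOfSESδ hT' ≫ e₁.inv⟦(1 : ℤ)⟧', ?_⟩
  refine isomorphic_distinguished _ (triangleOfSES_distinguished hT') _
    (Triangle.isoMk _ _ e₁ (e.app T.X₂) e₃ ?_ ?_ ?_)
  · exact e.hom.naturality T.f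
  · exact e.hom.naturality T.g
  · change (e₃.hom ≫ triangleOfSESδ hT' ≫ e₁.inv⟦(1 : ℤ)⟧') ≫ e₁.hom⟦(1 : ℤ)⟧' =
      e₃.hom ≫ triangleOfSESδ hT'
    rw [Category.assoc, Category.assoc, ← Functor.map_comp, Iso.inv_hom_id,
      CategoryTheory.Functor.map_id, Category.comp_id]

/-- `p` is the truncation to degrees `≥ b`, which leaves only the top homology of `X`. -/
lemma exists_truncGE_single (X : DerivedCategory A) (b : ℤ) [X.IsLE b] :
    ∃ (Y : A) (p : X ⟶ (singleFunctor A b).obj Y), IsIso ((homologyFunctor A b).map p) ∧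
      ∀ (Z : DerivedCategory A) [Z.IsGE b] (f : X ⟶ Z), ∃ g, f = p ≫ g := by
  obtain ⟨U, V, hU, hV, u, v, d, hT⟩ :=
    TStructure.t.exists_triangle X (b - 1) b (by lia)
  have : U.IsLE (b - 1) := ⟨hU⟩
  have : V.IsGE b := ⟨hV⟩
  have : V.IsLE b := by
    rw [isLE_iff]
    intro i hi
    refine (HomologySequence.exact₃ _ hT i (i + 1)).isZero_X₂ ?_ ?_
    · exact (isZero_of_isLE X b i hi).eq_of_src _ _
    · exact (isZero_of_isLE U (b - 1) (i + 1) (by lia)).eq_of_tgt _ _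
  obtain ⟨Y, ⟨e⟩⟩ := exists_iso_singleFunctor_obj_of_isGE_of_isLE V b
  have hv : IsIso ((homologyFunctor A b).map v) := by
    have : Mono ((homologyFunctor A b).map v) :=
      (HomologySequence.mono_homologyMap_mor₂_iff _ hT b).2
        ((isZero_of_isLE U (b - 1) b (by lia)).eq_of_src _ _)
    have : Epi ((homologyFunctor A b).map v) :=
      (HomologySequence.epi_homologyMap_mor₂_iff _ hT b (b + 1)).2
        ((isZero_of_isLE U (b - 1) (b + 1) (by lia)).eq_of_tgt _ _)
    exact isIso_of_mono_of_epi _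
  refine ⟨Y, v ≫ e.hom, ?_, fun Z _ f => ?_⟩
  · rw [Functor.map_comp]
    infer_instance
  · obtain ⟨g, hg⟩ : ∃ g : V ⟶ Z, f = v ≫ g := Triangle.yoneda_exact₂ _ hT f
      (TStructure.t.zero_of_isLE_of_isGE _ (b - 1) b (by lia) ‹_› ‹_›)
    refine ⟨e.inv ≫ g, ?_⟩
    rw [Category.assoc, Iso.hom_inv_id_assoc]
    exact hg

lemma exists_truncLE_single (X : DerivedCategory A) (a : ℤ) [X.IsGE a] :
    ∃ (Y : A) (q : (singleFunctor A a).obj Y ⟶ X), IsIso ((homologyFunctor A a).map q) := by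
  obtain ⟨U, V, hU, hV, u, v, d, hT⟩ :=
    TStructure.t.exists_triangle X a (a + 1) (by lia)
  have : U.IsLE a := ⟨hU⟩
  have : V.IsGE (a + 1) := ⟨hV⟩
  have : U.IsGE a := by
    rw [isGE_iff]
    intro i hi
    refine (HomologySequence.exact₁ _ hT (i - 1) i).isZero_X₂ ?_ ?_
    · exact (isZero_of_isGE V (a + 1) (i - 1) (by lia)).eq_of_src _ _
    · exact (isZero_of_isGE X a i (by lia)).eq_of_tgt _ _
  obtain ⟨Y, ⟨e⟩⟩ := exists_iso_singleFunctor_obj_of_isGE_of_isLE U a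
  have hu : IsIso ((homologyFunctor A a).map u) := by
    have : Mono ((homologyFunctor A a).map u) :=
      (HomologySequence.mono_homologyMap_mor₁_iff _ hT (a - 1) a).2
        ((isZero_of_isGE V (a + 1) (a - 1) (by lia)).eq_of_src _ _)
    have : Epi ((homologyFunctor A a).map u) :=
      (HomologySequence.epi_homologyMap_mor₁_iff _ hT a).2
        ((isZero_of_isGE V (a + 1) a (by lia)).eq_of_tgt _ _)
    exact isIso_of_mono_of_epi _
  refine ⟨Y, e.inv ≫ u, ?_⟩
  rw [Functor.map_comp]
  infer_instance

lemma exists_to_single (X : DerivedCategory A) (b : ℤ) [X.IsLE b] {S : A}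
    (f : (homologyFunctor A b).obj X ⟶ S) :
    ∃ p : X ⟶ (singleFunctor A b).obj S,
      (homologyFunctor A b).map p ≫ (homologySingleIso S b).hom = f := by
  obtain ⟨Y, p, _, -⟩ := exists_truncGE_single X b
  refine ⟨p ≫ (singleFunctor A b).map ((homologySingleIso Y b).inv ≫
    inv ((homologyFunctor A b).map p) ≫ f), ?_⟩
  rw [Functor.map_comp, Category.assoc, homologySingleIso_hom_naturality]
  simp

lemma exists_from_single (X : DerivedCategory A) (a : ℤ) [X.IsGE a] {S : A}
    (f : S ⟶ (homologyFunctor A a).obj X) :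
    ∃ q : (singleFunctor A a).obj S ⟶ X,
      (homologySingleIso S a).inv ≫ (homologyFunctor A a).map q = f := by
  obtain ⟨Y, q, _⟩ := exists_truncLE_single X a
  refine ⟨(singleFunctor A a).map (f ≫ inv ((homologyFunctor A a).map q) ≫
    (homologySingleIso Y a).hom) ≫ q, ?_⟩
  rw [Functor.map_comp, reassoc_of% (homologySingleIso_inv_naturality (A := A))]
  simp

/-- Truncation reduces `X` to its top and `Y` to its bottom homology, both in degree `b`, where the
single functor is fully faithful. -/
lemma eq_zero_of_homologyMap_eq_zero {X Y : DerivedCategory A} (b : ℤ) [X.IsLE b] [Y.IsGE b]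
    (f : X ⟶ Y) (hf : (homologyFunctor A b).map f = 0) : f = 0 := by
  obtain ⟨X', p, _, hp⟩ := exists_truncGE_single X b
  obtain ⟨f, rfl⟩ := hp Y f
  obtain ⟨U, V, hU, hV, u, v, d, hT⟩ :=
    TStructure.t.exists_triangle Y b (b + 1) (by lia)
  have : U.IsLE b := ⟨hU⟩
  have : V.IsGE (b + 1) := ⟨hV⟩
  have : U.IsGE b := by
    rw [isGE_iff]
    intro i hi
    refine (HomologySequence.exact₁ _ hT (i - 1) i).isZero_X₂ ?_ ?_
    · exact (isZero_of_isGE V (b + 1) (i - 1) (by lia)).eq_of_src _ _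
    · exact (isZero_of_isGE Y b i (by lia)).eq_of_tgt _ _
  have : Mono ((homologyFunctor A b).map u) :=
    (HomologySequence.mono_homologyMap_mor₁_iff _ hT (b - 1) b).2
      ((isZero_of_isGE V (b + 1) (b - 1) (by lia)).eq_of_src _ _)
  obtain ⟨g, hg⟩ : ∃ g : _ ⟶ U, f = g ≫ u := Triangle.coyoneda_exact₂ _ hT f
    (TStructure.t.zero_of_isLE_of_isGE (Y := V) _ b (b + 1) (by lia) inferInstance ‹_›)
  obtain ⟨Y', ⟨e⟩⟩ := exists_iso_singleFunctor_obj_of_isGE_of_isLE U b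
  obtain ⟨h, hh⟩ := (singleFunctor A b).map_surjective (g ≫ e.hom)
  have h₁ : (homologyFunctor A b).map f = 0 := by
    rw [Functor.map_comp] at hf
    rwa [← cancel_epi ((homologyFunctor A b).map p), comp_zero]
  have h₂ : (homologyFunctor A b).map g = 0 := by
    rw [← cancel_mono ((homologyFunctor A b).map u), zero_comp, ← Functor.map_comp, ← hg, h₁]
  have h₃ : h = 0 := by
    rw [← cancel_epi (homologySingleIso X' b).hom, ← homologySingleIso_hom_naturality, hh,
      Functor.map_comp, h₂, zero_comp, zero_comp, comp_zero]
  have h₄ : g = 0 := by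
    rw [← cancel_mono e.hom, ← hh, h₃, Functor.map_zero, zero_comp]
  rw [hg, h₄, zero_comp, comp_zero]

/-- Morphisms on homology which factor through `S` are induced by morphisms in the
derived category which factor through a shift of `S`. -/
lemma exists_comp_ne_zero {X L₁ L₂ : DerivedCategory A} (φ₁ : X ⟶ L₁) (φ₂ : L₂ ⟶ X) (b c : ℤ)
    [L₁.IsLE b] [L₂.IsGE c] {S : A} (p : (homologyFunctor A b).obj L₁ ⟶ S)
    (q : S ⟶ (homologyFunctor A c).obj L₂)
    (h : (homologyFunctor A b).map φ₁ ≫ p ≫ q ≫ (homologyFunctor A c).map φ₂ ≠ 0) :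
    ∃ (f : X ⟶ (singleFunctor A b).obj S) (g : (singleFunctor A b).obj S ⟶ X⟦c - b⟧),
      f ≫ g ≠ 0 := by
  obtain ⟨p', hp'⟩ := exists_to_single L₁ b p
  have : (L₂⟦c - b⟧).IsGE b := TStructure.t.isGE_shift L₂ c (c - b) b
  obtain ⟨q', hq'⟩ := exists_from_single (L₂⟦c - b⟧) b
    (q ≫ (homologyShiftIso L₂ (c - b) b c (by lia)).inv)
  refine ⟨φ₁ ≫ p', q' ≫ φ₂⟦c - b⟧', fun h0 => h ?_⟩
  have h1 := congrArg (fun t => (homologyFunctor A b).map t ≫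
    (homologyShiftIso X (c - b) b c (by lia)).hom) h0
  simp only [Functor.map_comp, Category.assoc, Functor.map_zero,
    homologyShiftIso_hom_naturality] at h1
  have h2 : q = (homologySingleIso S b).inv ≫ (homologyFunctor A b).map q' ≫
      (homologyShiftIso L₂ (c - b) b c (by lia)).hom := by
    rw [reassoc_of% hq', Iso.inv_hom_id, Category.comp_id]
  rw [h2, ← hp']
  simp only [Category.assoc, Iso.hom_inv_id_assoc]
  exact h1.trans zero_comp

/-- The connecting map `δ` of `T` sits in the middle of the composite, so homology does not see it.
If the composite vanished, `p' ≫ δ` would, up to `ι`, factor through `W⟦-1⟧`, with `W` the cone of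
the last map. Since `q` is mono, `W⟦-1⟧` lives in degrees `≥ b`, and its homology in degree `b` is a
quotient of the homology of `X` in degree `a`; `hq` kills the factorization. Then `p' ≫ δ = 0` and
`p` lifts to `T.X₂`, against `hp`. -/
lemma exists_comp_ne_zero_of_shortExact {X : DerivedCategory A} (a b : ℤ)
    [X.IsLE b] [X.IsGE a] {T : ShortComplex A} (hT : T.ShortExact)
    (p : (homologyFunctor A b).obj X ⟶ T.X₃)
    (hp : ∀ p' : (homologyFunctor A b).obj X ⟶ T.X₂, p' ≫ T.g ≠ p)
    (q : T.X₁ ⟶ (homologyFunctor A a).obj X) [Mono q]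
    (hq : ∀ (Y : A) (e : (homologyFunctor A a).obj X ⟶ Y) [Epi e]
      (f : (homologyFunctor A b).obj X ⟶ Y), f = 0) :
    ∃ (f : X ⟶ (singleFunctor A (b - 1)).obj T.X₁)
      (g : (singleFunctor A (b - 1)).obj T.X₁ ⟶ X⟦a - b + 1⟧), f ≫ g ≠ 0 := by
  obtain ⟨p', hp'⟩ := exists_to_single X b p
  obtain ⟨δ, hδ⟩ := exists_single_distinguished hT b
  let ι := ((singleFunctors A).shiftIso 1 (b - 1) b (by lia)).app T.X₁
  let n := a - b + 1
  have : (X⟦n⟧).IsGE (b - 1) := TStructure.t.isGE_shift X a n (b - 1)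
  let τ := homologyShiftIso X n (b - 1) a (by lia)
  obtain ⟨v, hv⟩ := exists_from_single (X⟦n⟧) (b - 1) (q ≫ τ.inv)
  have hmono : Mono ((homologyFunctor A (b - 1)).map v) := by
    have h : (homologyFunctor A (b - 1)).map v =
      (homologySingleIso T.X₁ (b - 1)).hom ≫ q ≫ τ.inv := by
      rw [← hv]; simp
    rw [h]
    infer_instance
  refine ⟨p' ≫ δ ≫ ι.hom, v, fun h0 => ?_⟩
  obtain ⟨W, y, z, hW⟩ := distinguished_cocone_triangle v
  have hWGE : W.IsGE (b - 1) := by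
    rw [isGE_iff]
    intro i hi
    have : Mono ((homologyFunctor A (i + 1)).map v) := by
      by_cases hi' : i + 1 = b - 1
      · rwa [hi']
      · exact ⟨fun _ _ _ => (isZero_of_isGE _ (b - 1) (i + 1) (by lia)).eq_of_tgt _ _⟩
    refine (HomologySequence.exact₃ _ hW i (i + 1)).isZero_X₂ ?_ ?_
    · exact (isZero_of_isGE (X⟦n⟧) (b - 1) i hi).eq_of_src _ _
    · exact (HomologySequence.mono_homologyMap_mor₁_iff _ hW i (i + 1)).1 this
  have : (W⟦(-1 : ℤ)⟧).IsGE b := TStructure.t.isGE_shift W (b - 1) (-1) b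
  have hy : Epi ((homologyFunctor A (b - 1)).map y) :=
    (HomologySequence.epi_homologyMap_mor₂_iff _ hW (b - 1) b).2
      ((isZero_of_isLE ((singleFunctor A (b - 1)).obj T.X₁) (b - 1) b (by lia)).eq_of_tgt _ _)
  obtain ⟨l, hl⟩ : ∃ l : X ⟶ W⟦(-1 : ℤ)⟧, p' ≫ δ ≫ ι.hom =
      l ≫ (Triangle.mk v y z).invRotate.mor₁ :=
    Triangle.coyoneda_exact₂ _ (inv_rot_of_distTriang _ hW) _ h0
  have hl0 : l = 0 := by
    refine eq_zero_of_homologyMap_eq_zero b l ?_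
    let κ := homologyShiftIso W (-1 : ℤ) b (b - 1) (by lia)
    have := hq _ (τ.inv ≫ (homologyFunctor A (b - 1)).map y)
      ((homologyFunctor A b).map l ≫ κ.hom)
    rw [← cancel_mono κ.hom]
    exact this.trans zero_comp.symm
  have hu : p' ≫ δ = 0 := by
    rw [← cancel_mono ι.hom, zero_comp, Category.assoc]
    exact hl.trans ((congrArg (· ≫ _) hl0).trans zero_comp)
  obtain ⟨m, hm⟩ : ∃ m : X ⟶ (singleFunctor A b).obj T.X₂, p' = m ≫ (singleFunctor A b).map T.g :=
    Triangle.coyoneda_exact₃ _ hδ p' hu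
  refine hp ((homologyFunctor A b).map m ≫ (homologySingleIso T.X₂ b).hom) ?_
  rw [← hp', hm, Functor.map_comp, Category.assoc, Category.assoc,
    homologySingleIso_hom_naturality]

end DerivedCategory

/-! ### Exact functors and homology. -/

namespace CategoryTheory.Functor

variable {A B : Type*} [Category* A] [Category* B] [Abelian A] [Abelian B]

/-- `F` commutes with homology and sees `f` as an isomorphism. It will be evaluation at one end of
an arrow, where `f` itself need not be invertible. -/
lemma isIso_map_homologyMap (F : A ⥤ B) [F.Additive] [F.PreservesHomology]
    {K L : CochainComplex A ℤ} (f : K ⟶ L) (n : ℤ) (hf : ∀ i, IsIso (F.map (f.f i))) :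
    IsIso (F.map (HomologicalComplex.homologyMap f n)) := by
  let g := (HomologicalComplex.shortComplexFunctor A (ComplexShape.up ℤ) n).map f
  have : IsIso (F.mapShortComplex.map g) := by
    have := hf ((ComplexShape.up ℤ).prev n)
    have := hf n
    have := hf ((ComplexShape.up ℤ).next n)
    have h₁ : IsIso (F.mapShortComplex.map g).τ₁ := hf ((ComplexShape.up ℤ).prev n)
    have h₂ : IsIso (F.mapShortComplex.map g).τ₂ := hf n
    have h₃ : IsIso (F.mapShortComplex.map g).τ₃ := hf ((ComplexShape.up ℤ).next n)
    exact ShortComplex.isIso_of_isIso _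
  have : IsIso ((F.mapShortComplex ⋙ ShortComplex.homologyFunctor B).map g) :=
    inferInstanceAs (IsIso ((ShortComplex.homologyFunctor B).map (F.mapShortComplex.map g)))
  exact (NatIso.isIso_map_iff (ShortComplex.homologyFunctorIso F) g).1 this

end CategoryTheory.Functor

namespace DerivedCategory

variable {A B : Type*} [Category* A] [Category* B] [Abelian A] [Abelian B]
  [HasDerivedCategory.{w} A]

lemma isIso_map_homologyMap (F : A ⥤ B) [F.Additive] [F.PreservesHomology]
    {K L : CochainComplex A ℤ} (f : K ⟶ L) (n : ℤ) (hf : ∀ i, IsIso (F.map (f.f i))) :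
    IsIso (F.map ((homologyFunctor A n).map (Q.map f))) :=
  (NatIso.isIso_map_iff (Functor.isoWhiskerRight (homologyFunctorFactors A n) F) f).2
    (F.isIso_map_homologyMap f n hf)

/-- The homology of `Q.obj K` in terms of the short complexes of `K`. -/
def homologyQIso (K : CochainComplex A ℤ) (n : ℤ) :
    (homologyFunctor A n).obj (Q.obj K) ≅ K.homology n :=
  (homologyFunctorFactors A n).app K

end DerivedCategory

/-! ### Arrows of modules, and functors isolating one end of an arrow. -/

namespace MorphismCategory

open ComposableArrows

variable {R : Type u} [CommRing R]

section maps

/-- The source `M` of a morphism `[M ⟶ N]`. -/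
abbrev src (F : ModArrow R) : ModuleCat.{u} R := F.obj' 0

/-- The target `N` of a morphism `[M ⟶ N]`. -/
abbrev tgt (F : ModArrow R) : ModuleCat.{u} R := F.obj' 1

/-- The structure morphism of `[M ⟶ N]`. -/
abbrev str (F : ModArrow R) : src F ⟶ tgt F := F.map' 0 1

abbrev srcMap {F G : ModArrow R} (f : F ⟶ G) : src F ⟶ src G := app' f 0

abbrev tgtMap {F G : ModArrow R} (f : F ⟶ G) : tgt F ⟶ tgt G := app' f 1

variable (k : ModuleCat.{u} R)

abbrev starArrow : ModArrow R := mk₁ (0 : ModuleCat.of R PUnit.{u + 1} ⟶ k)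
abbrev idArrow : ModArrow R := mk₁ (𝟙 k)
abbrev shriekArrow : ModArrow R := mk₁ (0 : k ⟶ ModuleCat.of R PUnit.{u + 1})

lemma str_comp_tgtMap {F G : ModArrow R} (f : F ⟶ G) : str F ≫ tgtMap f = srcMap f ≫ str G :=
  naturality' f 0 1

variable {k} (F : ModArrow R)

def toStar (p : tgt F ⟶ k) (h : str F ≫ p = 0) : F ⟶ starArrow k :=
  homMk₁ 0 p (h.trans zero_comp.symm)

def toId (p : tgt F ⟶ k) : F ⟶ idArrow k :=
  homMk₁ (str F ≫ p) p (Category.comp_id _).symm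

def toShriek (p : src F ⟶ k) : F ⟶ shriekArrow k :=
  homMk₁ p 0 (comp_zero.trans comp_zero.symm)

def fromStar (i : k ⟶ tgt F) : starArrow k ⟶ F :=
  homMk₁ 0 i (zero_comp.trans zero_comp.symm)

def fromId (i : k ⟶ src F) : idArrow k ⟶ F :=
  homMk₁ i (i ≫ str F) (Category.id_comp _)

def fromShriek (i : k ⟶ src F) (h : i ≫ str F = 0) : shriekArrow k ⟶ F :=
  homMk₁ i 0 (zero_comp.trans h.symm)

variable (k) in
/-- The short exact sequence `0 ⟶ [0 ⟶ k] ⟶ [k = k] ⟶ [k ⟶ 0] ⟶ 0`. -/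
def arrowShortComplex : ShortComplex (ModArrow R) :=
  ShortComplex.mk (fromStar (idArrow k) (𝟙 k)) (toShriek (idArrow k) (𝟙 k))
    (hom_ext₁ zero_comp comp_zero)

variable (k) in
lemma arrowShortComplex_shortExact : (arrowShortComplex k).ShortExact := by
  have hP : JointlyReflectIsomorphisms
      (fun j : Fin 2 => (evaluation (Fin 2) (ModuleCat.{u} R)).obj j) :=
    ⟨fun f hf => (NatTrans.isIso_iff_isIso_app f).2 hf⟩
  have h0 := ModuleCat.isZero_of_subsingleton (ModuleCat.of R PUnit.{u + 1})
  rw [hP.shortExact_iff]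
  intro j
  fin_cases j
  · exact
      { exact := (ShortComplex.exact_iff_mono _ (h0.eq_of_src _ _)).2 (inferInstanceAs (Mono (𝟙 k)))
        mono_f := ⟨fun _ _ _ => h0.eq_of_tgt _ _⟩
        epi_g := inferInstanceAs (Epi (𝟙 k)) }
  · exact
      { exact := (ShortComplex.exact_iff_epi _ (h0.eq_of_tgt _ _)).2 (inferInstanceAs (Epi (𝟙 k)))
        mono_f := inferInstanceAs (Mono (𝟙 k))
        epi_g := ⟨fun _ _ _ => h0.eq_of_src _ _⟩ }

lemma mono_fromStar (i : k ⟶ tgt F) [Mono i] : Mono (fromStar F i) := by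
  have : ∀ j, Mono ((fromStar F i).app j) := by
    intro j
    fin_cases j
    · exact ⟨fun _ _ _ => (ModuleCat.isZero_of_subsingleton (ModuleCat.of R PUnit)).eq_of_tgt _ _⟩
    · exact ‹Mono i›
  exact NatTrans.mono_of_mono_app _

end maps

section functors

/-- The functor `[M ⟶ N] ↦ [0 ⟶ N]`. -/
def starFunctor : ModArrow R ⥤ ModArrow R where
  obj F := starArrow (tgt F)
  map {F G} f := homMk₁ (𝟙 _) (tgtMap (F := F) (G := G) f) (zero_comp.trans comp_zero.symm)
  map_id _ := hom_ext₁ rfl rfl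
  map_comp _ _ := hom_ext₁ (Category.comp_id _).symm rfl

instance : (starFunctor (R := R)).Additive where
  map_add := hom_ext₁ ((ModuleCat.isZero_of_subsingleton (ModuleCat.of R PUnit)).eq_of_tgt _ _) rfl

def starFunctorι : starFunctor (R := R) ⟶ 𝟭 _ where
  app F := fromStar F (𝟙 _)
  naturality _ _ _ := hom_ext₁
    ((ModuleCat.isZero_of_subsingleton (ModuleCat.of R PUnit)).eq_of_src _ _)
    ((Category.comp_id _).trans (Category.id_comp _).symm)

/-- The functor `[M₀ ⟶ M₁] ↦ [M_j = M_j]`. -/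
abbrev constFunctor (j : Fin 2) : ModArrow R ⥤ ModArrow R :=
  (Functor.whiskeringLeft (Fin 2) (Fin 2) (ModuleCat.{u} R)).obj ((Functor.const _).obj j)

def constFunctorι : constFunctor (R := R) 0 ⟶ 𝟭 _ where
  app F := homMk₁ (𝟙 _) (str F) (by dsimp; simp)
  naturality F G f := hom_ext₁ (by dsimp; simp) (str_comp_tgtMap f).symm

def constFunctorπ : 𝟭 _ ⟶ constFunctor (R := R) 1 where
  app F := homMk₁ (str F) (𝟙 _) (by dsimp; simp)
  naturality F G f := hom_ext₁ (str_comp_tgtMap f).symm (by dsimp; simp)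

variable [HasDerivedCategory.{w} (ModArrow R)]

open DerivedCategory

lemma isIso_map_constFunctor_homology (K : CochainComplex (ModArrow R) ℤ) (j : Fin 2) (n : ℤ) :
    IsIso (str ((homologyFunctor _ n).obj
      (Q.obj (((constFunctor j).mapHomologicalComplex _).obj K)))) := by
  let e : (homologyFunctor _ n).obj (Q.obj (((constFunctor j).mapHomologicalComplex _).obj K)) ≅
      (constFunctor j).obj (K.homology n) :=
    homologyQIso _ n ≪≫ (K.sc n).mapHomologyIso (constFunctor j)
  have : IsIso (str ((constFunctor j).obj (K.homology n))) := by
    dsimp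
    infer_instance
  exact (NatIso.isIso_map_iff e _).2 this

/-- Applying `starFunctor` termwise discards the sources, so the lowest degree of `L` depends on the
targets `N_n` alone. -/
lemma exists_from_star (X : DerivedCategory (ModArrow R)) :
    ∃ (L : DerivedCategory (ModArrow R)) (φ : L ⟶ X), ∀ n,
      IsIso (tgtMap ((homologyFunctor _ n).map φ)) ∧
      IsZero (src ((homologyFunctor _ n).obj L)) := by
  let K := Q.objPreimage X
  let e : Q.obj K ≅ X := Q.objObjPreimageIso X
  let L := ((starFunctor (R := R)).mapHomologicalComplex (ComplexShape.up ℤ)).obj K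
  let f : L ⟶ K := (NatTrans.mapHomologicalComplex starFunctorι (ComplexShape.up ℤ)).app K
  refine ⟨Q.obj L, Q.map f ≫ e.hom, fun n => ⟨?_, ?_⟩⟩
  · have := isIso_map_homologyMap ((evaluation (Fin 2) (ModuleCat.{u} R)).obj 1) f n
      (fun i => inferInstanceAs (IsIso (𝟙 _)))
    have h : tgtMap ((homologyFunctor _ n).map (Q.map f ≫ e.hom)) =
        ((evaluation (Fin 2) (ModuleCat.{u} R)).obj 1).map ((homologyFunctor _ n).map (Q.map f)) ≫
        ((evaluation (Fin 2) (ModuleCat.{u} R)).obj 1).map ((homologyFunctor _ n).map e.hom) := by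
      rw [Functor.map_comp]
      rfl
    rw [h]
    infer_instance
  · let F := (evaluation (Fin 2) (ModuleCat.{u} R)).obj 0
    refine IsZero.of_iso ?_ (F.mapIso (homologyQIso L n) ≪≫ ((L.sc n).mapHomologyIso F).symm)
    exact ShortComplex.isZero_homology_of_isZero_X₂ _
      (ModuleCat.isZero_of_subsingleton (ModuleCat.of R PUnit.{u + 1}))

/-- Here `L` is `[M = M]`, so its lowest degree depends on the sources alone; `exists_to_const` is
the dual, with `[N = N]`. -/
lemma exists_from_const (X : DerivedCategory (ModArrow R)) :
    ∃ (L : DerivedCategory (ModArrow R)) (φ : L ⟶ X), ∀ n,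
      IsIso (srcMap ((homologyFunctor _ n).map φ)) ∧
      IsIso (str ((homologyFunctor _ n).obj L)) := by
  let K := Q.objPreimage X
  let e : Q.obj K ≅ X := Q.objObjPreimageIso X
  let L := ((constFunctor (R := R) 0).mapHomologicalComplex (ComplexShape.up ℤ)).obj K
  let f : L ⟶ K := (NatTrans.mapHomologicalComplex constFunctorι (ComplexShape.up ℤ)).app K
  refine ⟨Q.obj L, Q.map f ≫ e.hom, fun n => ⟨?_, isIso_map_constFunctor_homology K 0 n⟩⟩
  have := isIso_map_homologyMap ((evaluation (Fin 2) (ModuleCat.{u} R)).obj 0) f n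
    (fun i => inferInstanceAs (IsIso (𝟙 _)))
  have h : srcMap ((homologyFunctor _ n).map (Q.map f ≫ e.hom)) =
      ((evaluation (Fin 2) (ModuleCat.{u} R)).obj 0).map ((homologyFunctor _ n).map (Q.map f)) ≫
      ((evaluation (Fin 2) (ModuleCat.{u} R)).obj 0).map ((homologyFunctor _ n).map e.hom) := by
    rw [Functor.map_comp]
    rfl
  rw [h]
  infer_instance

lemma exists_to_const (X : DerivedCategory (ModArrow R)) :
    ∃ (L : DerivedCategory (ModArrow R)) (φ : X ⟶ L), ∀ n,
      IsIso (tgtMap ((homologyFunctor _ n).map φ)) ∧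
      IsIso (str ((homologyFunctor _ n).obj L)) := by
  let K := Q.objPreimage X
  let e : Q.obj K ≅ X := Q.objObjPreimageIso X
  let L := ((constFunctor (R := R) 1).mapHomologicalComplex (ComplexShape.up ℤ)).obj K
  let f : K ⟶ L := (NatTrans.mapHomologicalComplex constFunctorπ (ComplexShape.up ℤ)).app K
  refine ⟨Q.obj L, e.inv ≫ Q.map f, fun n => ⟨?_, isIso_map_constFunctor_homology K 1 n⟩⟩
  have := isIso_map_homologyMap ((evaluation (Fin 2) (ModuleCat.{u} R)).obj 1) f n
    (fun i => inferInstanceAs (IsIso (𝟙 _)))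
  have h : tgtMap ((homologyFunctor _ n).map (e.inv ≫ Q.map f)) =
      ((evaluation (Fin 2) (ModuleCat.{u} R)).obj 1).map ((homologyFunctor _ n).map e.inv) ≫
      ((evaluation (Fin 2) (ModuleCat.{u} R)).obj 1).map ((homologyFunctor _ n).map (Q.map f)) := by
    rw [Functor.map_comp]
    rfl
  rw [h]
  infer_instance

end functors

/-! ### The residue field as quotient and submodule. -/

section modules

variable [IsLocalRing R]

lemma nonempty_linearEquiv_residueField (M : Type*) [AddCommGroup M] [Module R M]
    [IsSimpleModule R M] : Nonempty (M ≃ₗ[R] IsLocalRing.ResidueField R) := by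
  obtain ⟨m, hm, ⟨e⟩⟩ := (isSimpleModule_iff_quot_maximal (R := R) (M := M)).mp ‹_›
  obtain rfl := IsLocalRing.eq_maximalIdeal hm
  exact ⟨e⟩

lemma exists_ne_zero_to_residueField (M : ModuleCat.{u} R) [Module.Finite R M]
    (hM : ¬ IsZero M) : ∃ p : M ⟶ ModuleCat.of R (IsLocalRing.ResidueField R), p ≠ 0 := by
  have : Nontrivial M := by
    rw [← not_subsingleton_iff_nontrivial]
    exact fun h => hM (ModuleCat.isZero_of_subsingleton M)
  obtain ⟨N, hN, -⟩ := (eq_top_or_exists_le_coatom (⊥ : Submodule R M)).resolve_left bot_ne_top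
  have : IsSimpleModule R (M ⧸ N) := isSimpleModule_iff_isCoatom.2 hN
  obtain ⟨e⟩ := nonempty_linearEquiv_residueField (R := R) (M ⧸ N)
  refine ⟨ModuleCat.ofHom (e.toLinearMap ∘ₗ N.mkQ), fun h => hN.1 ?_⟩
  rw [← N.ker_mkQ, LinearMap.ker_eq_top]
  ext x
  have : e (N.mkQ x) = 0 := congrArg (fun t => t.hom x) h
  simpa using this

/-- By the descending chain condition `M` has a minimal nonzero submodule; it is simple, and `k` is
the only simple module. -/
lemma exists_mono_from_residueField [IsArtinianRing R] (M : ModuleCat.{u} R)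
    [Module.Finite R M] (hM : ¬ IsZero M) :
    ∃ i : ModuleCat.of R (IsLocalRing.ResidueField R) ⟶ M, Mono i := by
  have : Nontrivial M := by
    rw [← not_subsingleton_iff_nontrivial]
    exact fun h => hM (ModuleCat.isZero_of_subsingleton M)
  have : IsAtomic (Submodule R M) := isAtomic_of_orderBot_wellFounded_lt wellFounded_lt
  obtain ⟨N, hN, -⟩ := (eq_bot_or_exists_atom_le (⊤ : Submodule R M)).resolve_left top_ne_bot
  have : IsSimpleModule R N := isSimpleModule_iff_isAtom.2 hN
  obtain ⟨e⟩ := nonempty_linearEquiv_residueField (R := R) N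
  refine ⟨ModuleCat.ofHom (N.subtype ∘ₗ e.symm.toLinearMap), ?_⟩
  rw [ModuleCat.mono_iff_injective]
  exact N.subtype_injective.comp e.symm.injective

lemma exists_ne_zero_of_not_epi {M N : ModuleCat.{u} R} [Module.Finite R N] (f : M ⟶ N)
    (hf : ¬ Epi f) : ∃ p : N ⟶ ModuleCat.of R (IsLocalRing.ResidueField R), p ≠ 0 ∧ f ≫ p = 0 := by
  have : Module.Finite R (cokernel f : ModuleCat.{u} R) :=
    Module.Finite.of_surjective (cokernel.π f).hom
      ((ModuleCat.epi_iff_surjective _).1 inferInstance)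
  obtain ⟨p, hp⟩ := exists_ne_zero_to_residueField (cokernel f)
    (fun h => hf (Preadditive.epi_of_isZero_cokernel f h))
  exact ⟨cokernel.π f ≫ p, fun h => hp (by rwa [← cancel_epi (cokernel.π f), comp_zero]), by simp⟩

lemma exists_mono_of_not_mono [IsArtinianRing R] {M N : ModuleCat.{u} R} [Module.Finite R M]
    (f : M ⟶ N) (hf : ¬ Mono f) :
    ∃ i : ModuleCat.of R (IsLocalRing.ResidueField R) ⟶ M, Mono i ∧ i ≫ f = 0 := by
  have : Module.Finite R (kernel f : ModuleCat.{u} R) :=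
    Module.Finite.of_injective (kernel.ι f).hom ((ModuleCat.mono_iff_injective _).1 inferInstance)
  obtain ⟨i, hi⟩ := exists_mono_from_residueField (kernel f)
    (fun h => hf (Preadditive.mono_of_isZero_kernel f h))
  exact ⟨i ≫ kernel.ι f, inferInstance, by simp⟩

end modules

end MorphismCategory

/-! ### Factorizations through the three residue arrows. -/

namespace MorphismCategory

open ComposableArrows DerivedCategory

variable {R : Type u} [CommRing R]

lemma isZero_of_isZero_obj {F : ModArrow R} (h₀ : IsZero (src F)) (h₁ : IsZero (tgt F)) :
    IsZero F := by
  rw [IsZero.iff_id_eq_zero]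
  exact hom_ext₁ (h₀.eq_of_src _ _) (h₁.eq_of_src _ _)

lemma isZero_obj_of_isZero {F : ModArrow R} (h : IsZero F) (j : Fin 2) : IsZero (F.obj j) :=
  ((evaluation (Fin 2) (ModuleCat.{u} R)).obj j).map_isZero h

lemma ne_zero_of_app_ne_zero {F G : ModArrow R} (f : F ⟶ G) (j : Fin 2) (h : f.app j ≠ 0) :
    f ≠ 0 := by
  rintro rfl
  exact h rfl

variable (R) in
/-- The morphisms `[0 ⟶ k]`, `[k = k]` and `[k ⟶ 0]` where `k` is the residue field. -/
def residueArrows [IsLocalRing R] : ObjectProperty (ModArrow R) := fun S =>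
  S = starArrow (ModuleCat.of R (IsLocalRing.ResidueField R)) ∨
  S = idArrow (ModuleCat.of R (IsLocalRing.ResidueField R)) ∨
  S = shriekArrow (ModuleCat.of R (IsLocalRing.ResidueField R))

/-- An endomorphism of such an arrow amounts to one endomorphism of the simple module `k`. -/
lemma isIso_of_residueArrows [IsLocalRing R] {S : ModArrow R} (hS : residueArrows R S)
    (e : S ⟶ S) (he : e ≠ 0) : IsIso e := by
  let k := ModuleCat.of R (IsLocalRing.ResidueField R)
  have h0 := ModuleCat.isZero_of_subsingleton (ModuleCat.of R PUnit.{u + 1})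
  have hk : ∀ f : k ⟶ k, f ≠ 0 → IsIso f := fun f hf => by
    have : IsSimpleModule R (R ⧸ IsLocalRing.maximalIdeal R) :=
      isSimpleModule_iff_isCoatom.2 (Ideal.isMaximal_def.1 inferInstance)
    have : IsSimpleModule R k := this
    exact isIso_of_hom_simple hf
  have hz : ∀ (M : ModuleCat.{u} R) (f : M ⟶ M), IsZero M → IsIso f := fun M f hM =>
    ⟨0, hM.eq_of_src _ _, hM.eq_of_src _ _⟩
  rw [NatTrans.isIso_iff_isIso_app]
  rcases hS with rfl | rfl | rfl
  · have h : tgtMap e ≠ 0 := fun h => he (hom_ext₁ (h0.eq_of_src _ _) h)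
    intro j
    fin_cases j
    · exact hz _ _ h0
    · exact hk _ h
  · have h01 : srcMap e = tgtMap e :=
      ((Category.comp_id _).symm.trans (str_comp_tgtMap e).symm).trans (Category.id_comp _)
    have h : srcMap e ≠ 0 := fun h => he (hom_ext₁ h (h01.symm.trans h))
    intro j
    fin_cases j
    · exact hk _ h
    · exact hk _ fun h' => h (h01.trans h')
  · have h : srcMap e ≠ 0 := fun h => he (hom_ext₁ h (h0.eq_of_src _ _))
    intro j
    fin_cases j
    · exact hk _ h
    · exact hz _ _ h0

section

variable [HasDerivedCategory.{w} (ModArrow R)]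

/-- There are a morphism `S` in `residueArrows R` and `n ≤ 0` such that some nonzero map
`X ⟶ X⟦n⟧` factors through a shift of `S`. -/
def HasFactorization [IsLocalRing R] (X : DerivedCategory (ModArrow R)) : Prop :=
  ∃ (S : ModArrow R) (m n : ℤ) (f : X ⟶ (singleFunctor _ m).obj S)
    (g : (singleFunctor _ m).obj S ⟶ X⟦n⟧), residueArrows R S ∧ n ≤ 0 ∧ f ≫ g ≠ 0

lemma exists_homology_ne_zero (X : DerivedCategory (ModArrow R)) (hX : ¬ IsZero X) (a : ℤ)
    [X.IsGE a] : ∃ n, ¬ IsZero ((homologyFunctor _ n).obj X) := by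
  by_contra! h
  have : X.IsLE (a - 1) := by
    rw [isLE_iff]
    exact fun i _ => h i
  exact hX (TStructure.t.isZero X (a - 1) a (by lia))

variable [IsLocalRing R] [IsArtinianRing R]

lemma hasFactorization_of_not_epi {X : DerivedCategory (ModArrow R)}
    (hX : coherentCohomology R X) (a b : ℤ) [X.IsGE a] [X.IsLE b]
    (hb : ¬ Epi (str ((homologyFunctor _ b).obj X))) : HasFactorization X := by
  have (n : ℤ) (j : Fin 2) : Module.Finite R (((homologyFunctor _ n).obj X).obj j) := hX n j
  obtain ⟨p, hp, hp'⟩ := exists_ne_zero_of_not_epi _ hb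
  obtain ⟨L, φ, hφ⟩ := exists_from_star X
  obtain ⟨c, hc, hmin⟩ := Int.exists_least_of_bdd
    (P := fun n => ¬ IsZero (tgt ((homologyFunctor _ n).obj X)))
    ⟨a, fun n hn => not_lt.1 fun h => hn (isZero_obj_of_isZero (isZero_of_isGE X a n h) _)⟩
    ⟨b, fun h => hp (h.eq_of_src _ _)⟩
  have : L.IsGE c := by
    rw [isGE_iff]
    intro i hi
    refine isZero_of_isZero_obj (hφ i).2 ?_
    have := (hφ i).1
    refine IsZero.of_iso ?_ (asIso (tgtMap ((homologyFunctor _ i).map φ)))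
    by_contra h
    exact absurd (hmin i h) (not_le.2 hi)
  obtain ⟨i, _⟩ := exists_mono_from_residueField _ hc
  have := (hφ c).1
  obtain ⟨f, g, hfg⟩ := exists_comp_ne_zero (𝟙 X) φ b c (toStar _ p hp')
    (fromStar _ (i ≫ inv (tgtMap ((homologyFunctor _ c).map φ)))) (by
      refine ne_zero_of_app_ne_zero _ 1 ?_
      rw [CategoryTheory.Functor.map_id, Category.id_comp]
      change p ≫ (i ≫ inv (tgtMap ((homologyFunctor _ c).map φ))) ≫
        tgtMap ((homologyFunctor _ c).map φ) ≠ 0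
      rw [Category.assoc, IsIso.inv_hom_id, Category.comp_id]
      exact fun h => hp (by rwa [← cancel_mono i, zero_comp]))
  exact ⟨_, b, c - b, f, g, Or.inl rfl, sub_nonpos.2 (hmin b fun h => hp (h.eq_of_src _ _)), hfg⟩

/-- Nonvanishing is read off on sources: `M_b ⟶ N_b ⟶ k` is nonzero because its first map is epi. -/
lemma hasFactorization_of_epi {X : DerivedCategory (ModArrow R)}
    (hX : coherentCohomology R X) (a b : ℤ) [X.IsGE a] [X.IsLE b]
    [Epi (str ((homologyFunctor _ b).obj X))]
    (hb : ¬ IsZero (tgt ((homologyFunctor _ b).obj X))) : HasFactorization X := by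
  have (n : ℤ) (j : Fin 2) : Module.Finite R (((homologyFunctor _ n).obj X).obj j) := hX n j
  obtain ⟨p, hp⟩ := exists_ne_zero_to_residueField _ hb
  have hp' : str ((homologyFunctor _ b).obj X) ≫ p ≠ 0 :=
    fun h => hp (by rwa [← cancel_epi (str ((homologyFunctor _ b).obj X)), comp_zero])
  obtain ⟨L, φ, hφ⟩ := exists_from_const X
  obtain ⟨c, hc, hmin⟩ := Int.exists_least_of_bdd
    (P := fun n => ¬ IsZero (src ((homologyFunctor _ n).obj X)))
    ⟨a, fun n hn => not_lt.1 fun h => hn (isZero_obj_of_isZero (isZero_of_isGE X a n h) _)⟩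
    ⟨b, fun h => hp' (h.eq_of_src _ _)⟩
  have : L.IsGE c := by
    rw [isGE_iff]
    intro i hi
    have h₀ : IsZero (src ((homologyFunctor _ i).obj L)) := by
      have := (hφ i).1
      refine IsZero.of_iso ?_ (asIso (srcMap ((homologyFunctor _ i).map φ)))
      by_contra h
      exact absurd (hmin i h) (not_le.2 hi)
    have := (hφ i).2
    exact isZero_of_isZero_obj h₀ (h₀.of_iso (asIso (str ((homologyFunctor _ i).obj L))).symm)
  obtain ⟨i, _⟩ := exists_mono_from_residueField _ hc
  have := (hφ c).1
  obtain ⟨f, g, hfg⟩ := exists_comp_ne_zero (𝟙 X) φ b c (toId _ p)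
    (fromId _ (i ≫ inv (srcMap ((homologyFunctor _ c).map φ)))) (by
      refine ne_zero_of_app_ne_zero _ 0 ?_
      rw [CategoryTheory.Functor.map_id, Category.id_comp]
      change (str ((homologyFunctor _ b).obj X) ≫ p) ≫
        (i ≫ inv (srcMap ((homologyFunctor _ c).map φ))) ≫
        srcMap ((homologyFunctor _ c).map φ) ≠ 0
      rw [Category.assoc i, IsIso.inv_hom_id, Category.comp_id]
      exact fun h => hp' (by rwa [← cancel_mono i, zero_comp]))
  exact ⟨_, b, c - b, f, g, Or.inr (Or.inl rfl),
    sub_nonpos.2 (hmin b fun h => hp' (h.eq_of_src _ _)), hfg⟩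

lemma hasFactorization_of_not_mono {X : DerivedCategory (ModArrow R)}
    (hX : coherentCohomology R X) (a b : ℤ) [X.IsGE a] [X.IsLE b] (hab : a ≤ b)
    (hb : ¬ IsZero (src ((homologyFunctor _ b).obj X)))
    (ha : ¬ Mono (str ((homologyFunctor _ a).obj X))) : HasFactorization X := by
  have (n : ℤ) (j : Fin 2) : Module.Finite R (((homologyFunctor _ n).obj X).obj j) := hX n j
  obtain ⟨p, hp⟩ := exists_ne_zero_to_residueField _ hb
  obtain ⟨i, _, hi⟩ := exists_mono_of_not_mono _ ha
  obtain ⟨f, g, hfg⟩ := exists_comp_ne_zero (𝟙 X) (𝟙 X) b a (toShriek _ p)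
    (fromShriek _ i hi) (by
      refine ne_zero_of_app_ne_zero _ 0 ?_
      rw [CategoryTheory.Functor.map_id, CategoryTheory.Functor.map_id, Category.id_comp,
        Category.comp_id]
      change p ≫ i ≠ 0
      exact fun h => hp (by rwa [← cancel_mono i, zero_comp]))
  exact ⟨_, b, a - b, f, g, Or.inr (Or.inr rfl), sub_nonpos.2 hab, hfg⟩

/-- Nonvanishing is read off on targets: `k ⟶ M_a ⟶ N_a` stays mono. -/
lemma hasFactorization_of_mono {X : DerivedCategory (ModArrow R)}
    (hX : coherentCohomology R X) (a b : ℤ) [X.IsGE a] [X.IsLE b]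
    [Mono (str ((homologyFunctor _ a).obj X))]
    (ha : ¬ IsZero (src ((homologyFunctor _ a).obj X))) : HasFactorization X := by
  have (n : ℤ) (j : Fin 2) : Module.Finite R (((homologyFunctor _ n).obj X).obj j) := hX n j
  obtain ⟨i, _⟩ := exists_mono_from_residueField _ ha
  have ha' : ¬ IsZero (tgt ((homologyFunctor _ a).obj X)) := fun h =>
    ha (h.of_mono (str ((homologyFunctor _ a).obj X)))
  obtain ⟨L, φ, hφ⟩ := exists_to_const X
  obtain ⟨c, hc, hmax⟩ := Int.exists_greatest_of_bdd
    (P := fun n => ¬ IsZero (tgt ((homologyFunctor _ n).obj X)))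
    ⟨b, fun n hn => not_lt.1 fun h => hn (isZero_obj_of_isZero (isZero_of_isLE X b n h) _)⟩
    ⟨a, ha'⟩
  have : L.IsLE c := by
    rw [isLE_iff]
    intro i hi
    have h₁ : IsZero (tgt ((homologyFunctor _ i).obj L)) := by
      have := (hφ i).1
      refine IsZero.of_iso ?_ (asIso (tgtMap ((homologyFunctor _ i).map φ))).symm
      by_contra h
      exact absurd (hmax i h) (not_le.2 hi)
    have := (hφ i).2
    exact isZero_of_isZero_obj (h₁.of_iso (asIso (str ((homologyFunctor _ i).obj L)))) h₁
  obtain ⟨p, hp⟩ := exists_ne_zero_to_residueField _ hc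
  have := (hφ c).1
  obtain ⟨f, g, hfg⟩ := exists_comp_ne_zero φ (𝟙 X) c a
    (toId _ (inv (tgtMap ((homologyFunctor _ c).map φ)) ≫ p)) (fromId _ i) (by
      refine ne_zero_of_app_ne_zero _ 1 ?_
      rw [CategoryTheory.Functor.map_id, Category.comp_id]
      change tgtMap ((homologyFunctor _ c).map φ) ≫
        (inv (tgtMap ((homologyFunctor _ c).map φ)) ≫ p) ≫
        i ≫ str ((homologyFunctor _ a).obj X) ≠ 0
      rw [Category.assoc, IsIso.hom_inv_id_assoc]
      intro h
      exact hp (by rwa [← cancel_mono (i ≫ str ((homologyFunctor _ a).obj X)), zero_comp]))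
  exact ⟨_, c, a - c, f, g, Or.inr (Or.inl rfl), sub_nonpos.2 (hmax a ha'), hfg⟩

/-- A map from the top homology, supported on sources, to a quotient of the bottom one, supported on
targets, is zero. A lift of `p` to `[k = k]` would have source component passing through `N_b = 0`.
Since `a < b`, the shift `a - b + 1` is still nonpositive. -/
lemma hasFactorization_of_isZero {X : DerivedCategory (ModArrow R)}
    (hX : coherentCohomology R X) (a b : ℤ) [X.IsGE a] [X.IsLE b] (hab : a < b)
    (hb₁ : IsZero (tgt ((homologyFunctor _ b).obj X)))
    (hb₀ : ¬ IsZero (src ((homologyFunctor _ b).obj X)))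
    (ha₀ : IsZero (src ((homologyFunctor _ a).obj X)))
    (ha₁ : ¬ IsZero (tgt ((homologyFunctor _ a).obj X))) : HasFactorization X := by
  have (n : ℤ) (j : Fin 2) : Module.Finite R (((homologyFunctor _ n).obj X).obj j) := hX n j
  obtain ⟨p, hp⟩ := exists_ne_zero_to_residueField _ hb₀
  obtain ⟨i, _⟩ := exists_mono_from_residueField _ ha₁
  let q : (arrowShortComplex (ModuleCat.of R (IsLocalRing.ResidueField R))).X₁ ⟶
    (homologyFunctor _ a).obj X := fromStar _ i
  have : Mono q := mono_fromStar _ i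
  obtain ⟨f, g, hfg⟩ := exists_comp_ne_zero_of_shortExact a b (X := X)
    (arrowShortComplex_shortExact (ModuleCat.of R (IsLocalRing.ResidueField R))) (toShriek _ p)
    (fun p' h => hp (by
      have h₀ : srcMap p' = 0 := by
        have := str_comp_tgtMap p'
        rw [hb₁.eq_of_src (tgtMap p') 0, comp_zero] at this
        exact (Category.comp_id _).symm.trans this.symm
      have h' : srcMap p' ≫ 𝟙 _ = p := congrArg (fun t => srcMap t) h
      rw [← h', h₀]; exact zero_comp))
    q
    (fun Y e _ f => hom_ext₁
      ((IsZero.of_epi (e.app 0) ha₀).eq_of_tgt _ _) (hb₁.eq_of_src _ _))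
  exact ⟨_, b - 1, a - b + 1, f, g, Or.inl rfl, by lia, hfg⟩

/-- A nonzero object with bounded and finitely generated cohomology has a nonzero morphism to
a non-positive shift of itself which factors through a shift of one of the three morphisms
`[0 ⟶ k]`, `[k = k]`, `[k ⟶ 0]`. -/
theorem hasFactorization {X : DerivedCategory (ModArrow R)} (hX : boundedCoherent R X)
    (hX₀ : ¬ IsZero X) : HasFactorization X := by
  obtain ⟨hX, ⟨a', _⟩, ⟨b', _⟩⟩ := hX
  have hne := exists_homology_ne_zero X hX₀ a'
  obtain ⟨a, ha, hmin⟩ := Int.exists_least_of_bdd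
    (P := fun n => ¬ IsZero ((homologyFunctor _ n).obj X))
    ⟨a', fun n hn => not_lt.1 fun h => hn (isZero_of_isGE X a' n h)⟩ hne
  obtain ⟨b, hb, hmax⟩ := Int.exists_greatest_of_bdd
    (P := fun n => ¬ IsZero ((homologyFunctor _ n).obj X))
    ⟨b', fun n hn => not_lt.1 fun h => hn (isZero_of_isLE X b' n h)⟩ hne
  have : X.IsGE a := (isGE_iff _ _).2 fun i hi => by
    by_contra h
    exact absurd (hmin i h) (not_le.2 hi)
  have : X.IsLE b := (isLE_iff _ _).2 fun i hi => by
    by_contra h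
    exact absurd (hmax i h) (not_le.2 hi)
  by_cases hepi : Epi (str ((homologyFunctor _ b).obj X))
  swap
  · exact hasFactorization_of_not_epi hX a b hepi
  by_cases hb₁ : IsZero (tgt ((homologyFunctor _ b).obj X))
  swap
  · exact hasFactorization_of_epi hX a b hb₁
  have hb₀ : ¬ IsZero (src ((homologyFunctor _ b).obj X)) :=
    fun h => hb (isZero_of_isZero_obj h hb₁)
  by_cases hmono : Mono (str ((homologyFunctor _ a).obj X))
  swap
  · exact hasFactorization_of_not_mono hX a b (hmin b hb) hb₀ hmono
  by_cases ha₀ : IsZero (src ((homologyFunctor _ a).obj X))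
  swap
  · exact hasFactorization_of_mono hX a b ha₀
  refine hasFactorization_of_isZero hX a b (lt_of_le_of_ne (hmin b hb) ?_) hb₁ hb₀ ha₀
    fun h => ha (isZero_of_isZero_obj ha₀ h)
  rintro rfl
  exact hb₀ ha₀

end

end MorphismCategory

/-! ### Transfer to `M_R` and conclusion. -/

namespace MorphismCategory

open DerivedCategory

variable {R : Type u} [CommRing R] [HasDerivedCategory.{w} (ModArrow R)]

lemma isIso_of_ne_zero_singleFunctor [IsLocalRing R] {S : ModArrow R} (hS : residueArrows R S)
    (m : ℤ) (e : (singleFunctor _ m).obj S ⟶ (singleFunctor _ m).obj S) (he : e ≠ 0) :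
    IsIso e := by
  obtain ⟨e, rfl⟩ := (singleFunctor _ m).map_surjective e
  have := isIso_of_residueArrows hS e (by rintro rfl; exact he (Functor.map_zero _ _ _))
  infer_instance

variable [IsNoetherianRing R]

/-- The shift of an object of `M_R` in degree zero is in a single degree. -/
def shiftObjIsoSingle (Y : MR R) (S : ModArrow R) (e : Y.obj ≅ (singleFunctor _ 0).obj S) (m : ℤ) :
    (boundedCoherent R).ι.obj (Y⟦-m⟧) ≅ (singleFunctor _ m).obj S :=
  ((boundedCoherent R).ι.commShiftIso (-m)).app Y ≪≫ (shiftFunctor _ (-m)).mapIso e ≪≫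
    ((singleFunctors (ModArrow R)).shiftIso (-m) m 0 (by lia)).app S

lemma exists_residue_obj [IsLocalRing R] {S : ModArrow R} (hS : residueArrows R S) :
    ∃ Y : MR R, Nonempty (Y.obj ≅ (singleFunctor _ 0).obj S) ∧
      (Y = s (ModuleCat.of R (IsLocalRing.ResidueField R)) ∨
        Y = jShriek (ModuleCat.of R (IsLocalRing.ResidueField R)) ∨
        Y = jStar (ModuleCat.of R (IsLocalRing.ResidueField R))) := by
  rcases hS with rfl | rfl | rfl
  · exact ⟨jStar _, ⟨Iso.refl _⟩, .inr (.inr rfl)⟩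
  · exact ⟨s _, ⟨Iso.refl _⟩, .inl rfl⟩
  · exact ⟨jShriek _, ⟨Iso.refl _⟩, .inr (.inl rfl)⟩

theorem nonempty_iso_of_isStable [IsLocalRing R] [IsArtinianRing R]
    (σ : Bridgeland.StabilityCondition (MR R)) (X : MR R) (hX : σ.IsStable X) :
    ∃ (Y : MR R) (n : ℤ), Nonempty (X ≅ Y⟦n⟧) ∧
      (Y = s (ModuleCat.of R (IsLocalRing.ResidueField R)) ∨
        Y = jShriek (ModuleCat.of R (IsLocalRing.ResidueField R)) ∨
        Y = jStar (ModuleCat.of R (IsLocalRing.ResidueField R))) := by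
  have hX₀ : ¬ IsZero X.obj := fun h => by
    obtain ⟨φ, hφ, hs⟩ := hX
    refine id_nonzero (⟨X, hφ⟩ : (σ.P φ).FullSubcategory) ?_
    have : 𝟙 X = 0 := (boundedCoherent R).ι.map_injective (h.eq_of_src _ _)
    exact (σ.P φ).ι.map_injective this
  obtain ⟨S, m, n, f, g, hS, hn, hfg⟩ := hasFactorization X.property hX₀
  obtain ⟨Y, ⟨e⟩, hY⟩ := exists_residue_obj hS
  let e' := shiftObjIsoSingle Y S e m
  let ι := (boundedCoherent R).ι
  refine ⟨Y, -m, hX.nonempty_iso (fun u hu => ?_) hn (ι.preimage (f ≫ e'.inv))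
    (ι.preimage (e'.hom ≫ g ≫ (ι.commShiftIso n).inv.app X)) (fun h => hfg ?_), hY⟩
  · have h₁ := isIso_of_ne_zero_singleFunctor hS m (e'.inv ≫ ι.map u ≫ e'.hom) (fun h => hu <| by
      apply ι.map_injective
      rw [← cancel_epi e'.inv, ← cancel_mono e'.hom]
      simpa using h)
    have h₂ : IsIso (ι.map u) := by
      have : ι.map u = e'.hom ≫ (e'.inv ≫ ι.map u ≫ e'.hom) ≫ e'.inv := by simp
      rw [this]
      infer_instance
    exact isIso_of_reflects_iso u ι
  · have := congr_arg ι.map h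
    rw [Functor.map_comp, Functor.map_preimage, Functor.map_preimage, Functor.map_zero] at this
    rw [← cancel_mono ((ι.commShiftIso n).inv.app X)]
    simpa using this

end MorphismCategory

end

theorem mainTheorem5 (R : Type u) [CommRing R] [IsNoetherianRing R] [IsLocalRing R]
    (hR : ringKrullDim R = 0) [HasDerivedCategory.{w} (MorphismCategory.ModArrow R)]
    (σ : Bridgeland.StabilityCondition (MorphismCategory.MR R)) (hσ : σ.IsLocallyFinite)
    (f : MorphismCategory.MR R) (hf : σ.IsStable f) :
    ∃ n : ℤ,
      Nonempty (f ≅ (MorphismCategory.s (ModuleCat.of R (IsLocalRing.ResidueField R)))⟦n⟧) ∨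
      Nonempty (f ≅ (MorphismCategory.jShriek (ModuleCat.of R (IsLocalRing.ResidueField R)))⟦n⟧) ∨
      Nonempty (f ≅ (MorphismCategory.jStar (ModuleCat.of R (IsLocalRing.ResidueField R)))⟦n⟧) := by
  have : Ring.KrullDimLE 0 R := Ring.krullDimLE_iff.2 hR.le
  have : IsArtinianRing R := IsNoetherianRing.isArtinianRing_of_krullDimLE_zero
  obtain ⟨Y, n, hY, rfl | rfl | rfl⟩ := MorphismCategory.nonempty_iso_of_isStable σ f hf
  · exact ⟨n, .inl hY⟩
  · exact ⟨n, .inr (.inl hY)⟩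
  · exact ⟨n, .inr (.inr hY)⟩
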